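/- Let $d,m\in\mathbb N$, $p>1$, $h,\alpha,\beta>0$; let $|\cdot|$ be the Euclidean (Frobenius) norm on the space $\mathbb M^{m\times k}$ of real $m\times k$ matrices, write points of $\mathbb R^{d+1}$ as $(x,y)\in\mathbb R^d\times\mathbb R$, and write $(A'|\xi)\in\mathbb M^{m\times(d+1)}$ for the matrix with first $d$ columns $A'\in\mathbb M^{m\times d}$ and last column $\xi\in\mathbb R^m$. Let $f:\mathbb R^{d+1}\times\mathbb M^{m\times(d+1)}\to[0,+\infty)$ be a Carathéodory function (measurable in the first variable for every value of the second, and continuous in the second for almost every value of the first) with $$\alpha|B|^p\le f(X,B)\le\beta(1+|B|^p)\qquad\text{for all }X\in\mathbb R^{d+1},\ B\in\mathbb M^{m\times(d+1)}.$$ For $T>0$ let $$\mathcal W_T=\{u\in W^{1,p}((0,T)^d\times(-h,h),\mathbb R^m):\ u=0\text{ on }\partial((0,T)^d)\times(-h,h)\text{ in the sense of traces}\}$$ and, for $A\in\mathbb M^{m\times d}$, $$g_A(T)=\inf_{u\in\mathcal W_T}\frac1{2hT^d}\int_{(0,T)^d\times(-h,h)}f\big(x,y,(A+\nabla_xu\,|\,\partial_yu)\big)\,dx\,dy.$$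 (i) Suppose that for every $\eta>0$ there are $L_\eta>0$ and $\mathcal T_\eta\subset\mathbb R^d$ with $\mathcal T_\eta+[0,L_\eta]^d=\mathbb R^d$ such that for every $\tau\in\mathcal T_\eta$ there is $z_\tau\in\mathbb R$ with $|z_\tau|<\eta$ and $|f(X+(\tau,z_\tau),B)-f(X,B)|\le\eta(1+|B|^p)$ for all $X\in\mathbb R^{d+1}$ and $B\in\mathbb M^{m\times(d+1)}$. Then for every $A\in\mathbb M^{m\times d}$ the limit $\lim_{T\to+\infty}g_A(T)$ exists and is finite. (ii) The same conclusion holds, without the assumption in (i), if $f$ arises from a thin section of a periodic medium as follows. Let $\widetilde f:\mathbb R^{d+1}\times\mathbb M^{m\times(d+1)}\to[0,+\infty)$ be a Carathéodory function satisfying the same growth conditions and $\widetilde f(X+e_i,B)=\widetilde f(X,B)$ for all $X$, $B$ and all vectors $e_1,\dots,e_{d+1}$ of the standard basis; let $\nu\in\mathbb R^{d+1}$ be any unit vector, $\Pi=\{X:\langle X,\nu\rangle=0\}$, let $\phi$ be a linear isometry of $\mathbb R^{d+1}$ mapping $e_1,\dots,e_d$ to an orthonormal basis of $\Pi$ and $e_{d+1}$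 to $\nu$, let $R=\nabla\phi$ be its matrix, and let $f(X,B)=\widetilde f(\phi(X),BQ)$, where $Q=R$ or $Q=R^{-1}$. -/

import Mathlib

open MeasureTheory Filter Topology
open scoped Pointwise ContDiff

noncomputable section

namespace ThinFilm

/-- `ℝ^n` with its Euclidean structure. In `ℝ^{d+1}` the first `d` coordinates are the in-plane
variable `x`, the last one is the transversal variable `y`. -/
abbrev E (n : ℕ) : Type := EuclideanSpace ℝ (Fin n)

/-- The space of `m × n` real matrices. -/
abbrev M (m n : ℕ) : Type := Matrix (Fin m) (Fin n) ℝ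

/-- The Euclidean (Frobenius) norm `|A|` of a matrix. -/
def matNorm {m n : ℕ} (A : M m n) : ℝ := Real.sqrt (∑ i, ∑ j, A i j ^ 2)

/-- The matrix `(A | ξ)` with last column `ξ`. -/
def augment {m d : ℕ} (A : M m d) (ξ : Fin m → ℝ) : M m (d + 1) :=
  Matrix.of fun i => Fin.snoc (A i) (ξ i)

/-- The point `(x, y)` of `ℝ^{d+1} = ℝ^d × ℝ`. -/
def pair {d : ℕ} (x : E d) (y : ℝ) : E (d + 1) :=
  WithLp.toLp 2 (Fin.snoc (fun i => x i) y)

/-! ### Hypotheses on the energy density -/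

/-- Carathéodory functions: (Lebesgue) measurable in `x` for every `A`, continuous in `A` for
almost every `x`. -/
structure IsCaratheodory {n m : ℕ} (f : E n → M m n → ℝ) : Prop where
  measurable_left : ∀ A, AEMeasurable (fun x => f x A) volume
  continuous_right : ∀ᵐ x ∂(volume : Measure (E n)), Continuous (f x)

/-- Standard `p`-growth: `α |A|^p ≤ f(x, A) ≤ β (1 + |A|^p)`. -/
def HasPGrowth {n m : ℕ} (p α β : ℝ) (f : E n → M m n → ℝ) : Prop :=
  ∀ x A, α * matNorm A ^ p ≤ f x A ∧ f x A ≤ β * (1 + matNorm A ^ p)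

/-- `1`-periodicity in all coordinate directions. -/
def IsUnitPeriodic {n m : ℕ} (f : E n → M m n → ℝ) : Prop :=
  ∀ (x : E n) (A : M m n) (i : Fin n), f (x + EuclideanSpace.single i 1) A = f x A

/-- Geometric almost periodicity in the film directions: for all `η > 0` there are `L > 0` and
a set `𝒯 ⊆ ℝ^d` with `𝒯 + [0, L]^d = ℝ^d` such that every `τ ∈ 𝒯` can be corrected by some
`z ∈ ℝ` with `|z| < η` so that `|f(x + (τ, z), A) - f(x, A)| ≤ η (1 + |A|^p)` for all `x, A`. -/
def IsFilmAlmostPeriodic {d m : ℕ} (p : ℝ) (f : E (d + 1) → M m (d + 1) → ℝ) : Prop :=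
  ∀ η : ℝ, 0 < η → ∃ L : ℝ, 0 < L ∧ ∃ 𝒯 : Set (E d),
    𝒯 + {v : E d | ∀ i, v i ∈ Set.Icc 0 L} = Set.univ ∧
    ∀ τ ∈ 𝒯, ∃ z : ℝ, |z| < η ∧
      ∀ (x : E (d + 1)) (A : M m (d + 1)),
        |f (x + pair τ z) A - f x A| ≤ η * (1 + matNorm A ^ p)

/-! ### The thin film as a section of a periodic medium -/

/-- The hyperplane `Π = {x : ⟨x, ν⟩ = 0}`. -/
def hyperplane {n : ℕ} (ν : E n) : Set (E n) := {x | inner ℝ x ν = 0}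

/-- The linear isometry `φ` sends `e_1, …, e_d` into `Π` (hence to an orthonormal basis of `Π`)
and `e_{d+1}` to `ν`. -/
def IsFilmFrame {d : ℕ} (ν : E (d + 1)) (φ : E (d + 1) ≃ₗᵢ[ℝ] E (d + 1)) : Prop :=
  (∀ i : Fin d, φ (EuclideanSpace.single i.castSucc 1) ∈ hyperplane ν) ∧
    φ (EuclideanSpace.single (Fin.last d) 1) = ν

/-- The constant matrix `R = ∇φ`. -/
def gradMatrix {n : ℕ} (φ : E n ≃ₗᵢ[ℝ] E n) : M n n :=
  Matrix.of fun i j => φ (EuclideanSpace.single j 1) i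

/-- The density in film coordinates, `(x, A) ↦ ftilde(φ(x), A Q)`. -/
def filmDensity {n m : ℕ} (φ : E n ≃ₗᵢ[ℝ] E n) (Q : M n n) (ftilde : E n → M m n → ℝ) :
    E n → M m n → ℝ :=
  fun x A => ftilde (φ x) (A * Q)

/-! ### Sobolev functions on the film and the cell problems -/

/-- The identity `∫_Ω u ∂_j ψ = - ∫_Ω (∂_j u) ψ`, in all components, for one test function. -/
def GreenIdentity {n m : ℕ} (Ω : Set (E n)) (u : E n → Fin m → ℝ) (G : E n → M m n)
    (ψ : E n → ℝ) : Prop :=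
  ∀ (i : Fin m) (j : Fin n),
    ∫ x in Ω, u x i * fderiv ℝ ψ x (EuclideanSpace.single j 1) = - ∫ x in Ω, G x i j * ψ x

/-- `u ∈ W^{1,p}(Ω, ℝ^m)` with weak gradient `G`. -/
structure IsW1p {n m : ℕ} (p : ℝ) (Ω : Set (E n)) (u : E n → Fin m → ℝ) (G : E n → M m n) :
    Prop where
  memLp : ∀ i, MemLp (fun x => u x i) (ENNReal.ofReal p) (volume.restrict Ω)
  memLp_grad : ∀ i j, MemLp (fun x => G x i j) (ENNReal.ofReal p) (volume.restrict Ω)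
  weakGrad : ∀ ψ : E n → ℝ, ContDiff ℝ ∞ ψ → HasCompactSupport ψ → tsupport ψ ⊆ Ω →
    GreenIdentity Ω u G ψ

/-- The box `(0, T)^d × (-h, h)`. -/
def box (d : ℕ) (h T : ℝ) : Set (E (d + 1)) :=
  {x | (∀ i : Fin d, x i.castSucc ∈ Set.Ioo 0 T) ∧ x (Fin.last d) ∈ Set.Ioo (-h) h}

/-- The infinite strip `ℝ^d × (-h, h)`. -/
def strip (d : ℕ) (h : ℝ) : Set (E (d + 1)) := {x | x (Fin.last d) ∈ Set.Ioo (-h) h}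

/-- `u = 0` on the lateral boundary `∂((0, T)^d) × (-h, h)` in the sense of traces: Green's formula
on the box has no lateral boundary term, i.e. it holds without boundary term for all smooth test
functions that vanish near the top and the bottom of the strip but are arbitrary on the lateral
boundary. (Equivalently, the extension of `u` by `0` to the strip is weakly differentiable, with
gradient the extension of `G` by `0`.) -/
def HasZeroLateralTrace {d m : ℕ} (h T : ℝ) (u : E (d + 1) → Fin m → ℝ)
    (G : E (d + 1) → M m (d + 1)) : Prop :=
  ∀ ψ : E (d + 1) → ℝ, ContDiff ℝ ∞ ψ → HasCompactSupport ψ → tsupport ψ ⊆ strip d h →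
    GreenIdentity (box d h T) u G ψ

/-- `u ∈ 𝒲_T`, with weak gradient `G`. -/
def IsTestFunction {d m : ℕ} (p h T : ℝ) (u : E (d + 1) → Fin m → ℝ)
    (G : E (d + 1) → M m (d + 1)) : Prop :=
  IsW1p p (box d h T) u G ∧ HasZeroLateralTrace h T u G

/-- `g_A(T)`: the infimum over `u ∈ 𝒲_T` of
`(2 h T^d)⁻¹ ∫_{(0,T)^d × (-h,h)} f(x, y, (A + ∇_x u | ∂_y u)) dx dy`;
here `(A + ∇_x u | ∂_y u) = (A | 0) + ∇u`. -/
def cellMin {d m : ℕ} (p h : ℝ) (f : E (d + 1) → M m (d + 1) → ℝ) (A : M m d) (T : ℝ) : ℝ :=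
  sInf {e : ℝ | ∃ (u : E (d + 1) → Fin m → ℝ) (G : E (d + 1) → M m (d + 1)),
    IsTestFunction p h T u G ∧
      e = 1 / (2 * h * T ^ d) * ∫ x in box d h T, f x (augment A 0 + G x)}

end ThinFilm

end

/-! The cell energies are almost subadditive. A near-minimiser on the box of side `S`, extended by
zero across the lateral boundary, is copied into about `(T/S)^d` disjoint cells of the box of side
`T`, based at almost periods `τ`; elsewhere the displacement is zero. The uncovered part costs at
most `β (1 + |A|^p)` per unit volume, and its volume fraction is small once `S ≫ L` and `T ≫ S`.
Hence `g_A(T)` exceeds `g_A(S)` by little (`exists_cellMin_le_add`), and a bounded function with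
this property converges (`exists_tendsto_atTop_of_le_add`).

The difficulty is the vertical correction `z`: shifting a function by `(τ, z)` pushes it partly out
of the strip and leaves a gap of thickness `|z|` at one face. The gap is closed by reflecting the
shifted function about a hyperplane near that face (`IsStripSobolev.fold`). On the kept side almost
periodicity compares the energies. On the reflected side nothing relates the values of `f`, so only
the growth condition is used: the energy there is at most `β` times the mass of `1 + |B|^p` in a
layer at distance between `t` and `3t` from the face. The `N` layers with `t = 3^k δ` are disjoint,
so one of them carries at most the `N`-th part of the total mass (`exists_layer_integral_le`), and
coercivity bounds that mass for near-minimisers. The numbers `N`, `η` and therefore `L` do not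
depend on `S`, which is what allows `S → ∞` afterwards.

For a section of a periodic medium, integer translations are exact periods. A finite net of the
bounded heights of integer points over `Π` shows that those of height below `η` are relatively dense
along `Π`, whatever the direction `ν` (`exists_intPoint_near`). -/

namespace ThinFilm

/-! ### Superposition with a Carathéodory function, and `p`-growth -/

/-- The superposition of a Carathéodory function with a measurable matrix field is measurable. -/
theorem IsCaratheodory.aemeasurable_superposition {n m : ℕ} {f : E n → M m n → ℝ}
    (hf : IsCaratheodory f) {μ : Measure (E n)} (hμ : μ ≪ volume) {G : E n → M m n}
    (hG : ∀ i j, AEMeasurable (fun x => G x i j) μ) : AEMeasurable (fun x => f x (G x)) μ := by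
  let G₁ : E n → (Fin m → Fin n → ℝ) := fun x i j => G x i j
  have hG₁ : AEMeasurable G₁ μ :=
    aemeasurable_pi_lambda _ fun i => aemeasurable_pi_lambda _ fun j => hG i j
  obtain ⟨G₂, hG₂, hG₁₂⟩ := hG₁
  have hS : StronglyMeasurable G₂ := hG₂.stronglyMeasurable
  have hlim : AEMeasurable (fun x => f x (G₂ x)) μ := by
    -- For a simple field the superposition is a finite sum of sections `f(·, a)` cut off to
    -- measurable sets; continuity in the matrix variable passes to the limit.
    refine aemeasurable_of_tendsto_metrizable_ae atTop (f := fun k x => f x (hS.approx k x)) ?_ ?_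
    · intro k
      have heq : (fun x => f x (hS.approx k x)) = fun x =>
          ∑ a ∈ (hS.approx k).range, (hS.approx k ⁻¹' {a}).indicator (fun x => f x a) x := by
        funext x
        rw [Finset.sum_eq_single (hS.approx k x)]
        · simp
        · intro b _ hb
          exact Set.indicator_of_notMem (fun h => hb (by simpa using h.symm)) _
        · intro h
          exact absurd (SimpleFunc.mem_range_self _ x) h
      rw [heq]
      refine Finset.aemeasurable_fun_sum _ fun a _ => ?_
      exact ((hf.measurable_left a).mono_ac hμ).indicator
        ((hS.approx k).measurableSet_fiber a)
    · filter_upwards [hμ.ae_le hf.continuous_right] with x hx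
      exact (hx.tendsto (G₂ x)).comp (hS.tendsto_approx x)
  refine hlim.congr ?_
  filter_upwards [hG₁₂] with x hx
  exact congrArg (f x) hx.symm

theorem matNorm_nonneg {m n : ℕ} (B : M m n) : 0 ≤ matNorm B := Real.sqrt_nonneg _

theorem continuous_matNorm {m n : ℕ} : Continuous (matNorm : M m n → ℝ) := by
  unfold matNorm
  fun_prop

theorem matNorm_le_sum_abs {m n : ℕ} (B : M m n) : matNorm B ≤ ∑ i, ∑ j, |B i j| := by
  have h0 : ∀ i, 0 ≤ ∑ j, |B i j| := fun i => Finset.sum_nonneg fun j _ => abs_nonneg _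
  refine Real.sqrt_le_iff.2 ⟨Finset.sum_nonneg fun i _ => h0 i, ?_⟩
  calc ∑ i, ∑ j, B i j ^ 2 = ∑ i, ∑ j, |B i j| ^ 2 := by simp
    _ ≤ ∑ i, (∑ j, |B i j|) ^ 2 := Finset.sum_le_sum fun i _ =>
        Finset.sum_sq_le_sq_sum_of_nonneg fun j _ => abs_nonneg _
    _ ≤ (∑ i, ∑ j, |B i j|) ^ 2 := Finset.sum_sq_le_sq_sum_of_nonneg fun i _ => h0 i

/-- The growth weight `1 + |B|^p`. -/
noncomputable def growthWeight {m n : ℕ} (p : ℝ) (B : M m n) : ℝ := 1 + matNorm B ^ p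

theorem growthWeight_pos {m n : ℕ} (p : ℝ) (B : M m n) : 0 < growthWeight p B :=
  add_pos_of_pos_of_nonneg one_pos (Real.rpow_nonneg (matNorm_nonneg B) p)

theorem integrableOn_growthWeight {m n : ℕ} {p : ℝ} (hp : 1 < p) {Ω : Set (E n)}
    (hΩ : volume Ω ≠ ⊤) {G : E n → M m n}
    (hG : ∀ i j, MemLp (fun x => G x i j) (ENNReal.ofReal p) (volume.restrict Ω)) (B : M m n) :
    IntegrableOn (fun x => growthWeight p (B + G x)) Ω := by
  have : IsFiniteMeasure (volume.restrict Ω) := ⟨by simpa using hΩ.lt_top⟩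
  have hsum : MemLp (fun x => ∑ i, ∑ j, |(B + G x) i j|) (ENNReal.ofReal p)
      (volume.restrict Ω) :=
    memLp_finsetSum _ fun i _ => memLp_finsetSum _ fun j _ =>
      ((memLp_const (B i j)).add (hG i j)).abs
  have hmeas : AEStronglyMeasurable (fun x => matNorm (B + G x)) (volume.restrict Ω) := by
    have : AEMeasurable (fun x (i : Fin m) (j : Fin n) => B i j + G x i j) (volume.restrict Ω) :=
      aemeasurable_pi_lambda _ fun i => aemeasurable_pi_lambda _ fun j =>
        ((hG i j).aestronglyMeasurable.aemeasurable.const_add (B i j))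
    exact (Continuous.comp_aestronglyMeasurable (continuous_matNorm (m := m) (n := n))
      this.aestronglyMeasurable)
  have hnorm : MemLp (fun x => matNorm (B + G x)) (ENNReal.ofReal p) (volume.restrict Ω) := by
    refine hsum.mono hmeas (ae_of_all _ fun x => ?_)
    rw [Real.norm_of_nonneg (matNorm_nonneg _)]
    exact (matNorm_le_sum_abs _).trans (le_abs_self _)
  have hint := hnorm.integrable_norm_rpow (by simpa using by linarith) ENNReal.ofReal_ne_top
  rw [ENNReal.toReal_ofReal (by linarith)] at hint
  refine (integrable_const (1 : ℝ)).add (hint.congr (ae_of_all _ fun x => ?_))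
  simp only [Real.norm_of_nonneg (matNorm_nonneg _)]

theorem HasPGrowth.nonneg {n m : ℕ} {p α β : ℝ} {f : E n → M m n → ℝ} (hα : 0 < α)
    (hf : HasPGrowth p α β f) (x : E n) (B : M m n) : 0 ≤ f x B :=
  (mul_nonneg hα.le (Real.rpow_nonneg (matNorm_nonneg B) p)).trans (hf x B).1

theorem integrableOn_energy {n m : ℕ} {p α β : ℝ} (hp : 1 < p) (hα : 0 < α)
    {f : E n → M m n → ℝ} (hf : IsCaratheodory f) (hg : HasPGrowth p α β f) {Ω : Set (E n)}
    (hΩ : volume Ω ≠ ⊤) {G : E n → M m n}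
    (hG : ∀ i j, MemLp (fun x => G x i j) (ENNReal.ofReal p) (volume.restrict Ω)) (B : M m n) :
    IntegrableOn (fun x => f x (B + G x)) Ω := by
  refine ((integrableOn_growthWeight hp hΩ hG B).const_mul β).mono' ?_ (ae_of_all _ fun x => ?_)
  · exact (hf.aemeasurable_superposition Measure.absolutelyContinuous_restrict fun i j =>
      ((hG i j).aestronglyMeasurable.aemeasurable.const_add (B i j))).aestronglyMeasurable
  · rw [Real.norm_of_nonneg (hg.nonneg hα _ _)]
    exact (hg _ _).2

/-! ### Geometry of the boxes -/

@[simp] theorem pair_castSucc {d : ℕ} (x : E d) (y : ℝ) (i : Fin d) :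
    pair x y i.castSucc = x i := by simp [pair]

@[simp] theorem pair_last {d : ℕ} (x : E d) (y : ℝ) : pair x y (Fin.last d) = y := by
  simp [pair]

theorem measurableSet_box (d : ℕ) (h T : ℝ) : MeasurableSet (box d h T) := by
  have : box d h T = (⋂ i : Fin d, {x : E (d + 1) | x i.castSucc ∈ Set.Ioo 0 T}) ∩
      {x : E (d + 1) | x (Fin.last d) ∈ Set.Ioo (-h) h} := by
    ext x; simp [box]
  rw [this]
  have hm : ∀ i : Fin (d + 1), Measurable fun x : E (d + 1) => x i := fun i => by fun_prop
  exact (MeasurableSet.iInter fun i => hm _ measurableSet_Ioo).inter (hm _ measurableSet_Ioo)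

theorem volume_box (d : ℕ) (h : ℝ) {T : ℝ} (hT : 0 < T) :
    volume (box d h T) = ENNReal.ofReal (2 * h * T ^ d) := by
  let I : Fin (d + 1) → Set ℝ := Fin.snoc (fun _ : Fin d => Set.Ioo 0 T) (Set.Ioo (-h) h)
  have hbox : box d h T = WithLp.ofLp ⁻¹' (Set.univ.pi I) := by
    ext x
    simp [box, Set.mem_pi, Fin.forall_fin_succ', I]
  have hm : MeasurableSet (Set.univ.pi I) :=
    MeasurableSet.univ_pi fun i => by
      refine Fin.lastCases ?_ (fun j => ?_) i <;> simp [I]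
  rw [hbox, (PiLp.volume_preserving_ofLp (Fin (d + 1))).measure_preimage hm.nullMeasurableSet,
    volume_pi_pi, Fin.prod_univ_castSucc]
  simp only [I, Fin.snoc_castSucc, Fin.snoc_last, Real.volume_Ioo, sub_zero, Finset.prod_const,
    Finset.card_univ, Fintype.card_fin]
  rw [← ENNReal.ofReal_pow hT.le, ← ENNReal.ofReal_mul (by positivity)]
  congr 1
  ring

theorem volume_box_ne_top (d : ℕ) (h : ℝ) {T : ℝ} (hT : 0 < T) :
    volume (box d h T) ≠ ⊤ := by
  rw [volume_box d h hT]; exact ENNReal.ofReal_ne_top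

theorem integral_indicator_box_one (d : ℕ) {h T : ℝ} (hh : 0 < h) (hT : 0 < T) :
    ∫ x, (box d h T).indicator (fun _ => (1 : ℝ)) x = 2 * h * T ^ d := by
  rw [integral_indicator (measurableSet_box d h T)]
  simp [Measure.real, volume_box d h hT, ENNReal.toReal_ofReal, hh.le, hT.le]

/-! ### Weak derivatives and reflections -/

/-- `g` is the weak derivative of `u` in the `j`-th direction on `Ω`, both functions being defined
on the whole space. -/
def HasWeakDeriv {n : ℕ} (Ω : Set (E n)) (j : Fin n) (u g : E n → ℝ) : Prop :=
  ∀ ψ : E n → ℝ, ContDiff ℝ ∞ ψ → HasCompactSupport ψ → tsupport ψ ⊆ Ω →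
    ∫ x, u x * fderiv ℝ ψ x (EuclideanSpace.single j 1) = - ∫ x, g x * ψ x

/-- The sign of the `j`-th coordinate under the reflection of the last coordinate. -/
def flipSign {d : ℕ} (j : Fin (d + 1)) : ℝ := if j = Fin.last d then -1 else 1

theorem flipSign_mul_self {d : ℕ} (j : Fin (d + 1)) : flipSign j * flipSign j = 1 := by
  unfold flipSign; split_ifs <;> norm_num

@[simp] theorem flipSign_last (d : ℕ) : flipSign (Fin.last d) = -1 := by simp [flipSign]

@[simp] theorem flipSign_castSucc {d : ℕ} (i : Fin d) : flipSign i.castSucc = 1 := by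
  simp [flipSign, Fin.castSucc_ne_last]

theorem abs_flipSign {d : ℕ} (j : Fin (d + 1)) : |flipSign j| = 1 := by
  unfold flipSign; split_ifs <;> norm_num

/-- The reflection of the last coordinate. -/
noncomputable def flipLast (d : ℕ) : E (d + 1) ≃ₗᵢ[ℝ] E (d + 1) :=
  LinearIsometryEquiv.piLpCongrRight 2 fun i =>
    if i = Fin.last d then LinearIsometryEquiv.neg ℝ else LinearIsometryEquiv.refl ℝ ℝ

theorem flipLast_apply {d : ℕ} (x : E (d + 1)) (i : Fin (d + 1)) :
    flipLast d x i = flipSign i * x i := by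
  simp only [flipLast, LinearIsometryEquiv.piLpCongrRight_apply, flipSign]
  split_ifs <;> simp

theorem flipLast_flipLast {d : ℕ} (x : E (d + 1)) : flipLast d (flipLast d x) = x := by
  ext i
  rw [flipLast_apply, flipLast_apply, ← mul_assoc, flipSign_mul_self, one_mul]

theorem flipLast_single {d : ℕ} (j : Fin (d + 1)) :
    flipLast d (EuclideanSpace.single j 1) = flipSign j • EuclideanSpace.single j (1 : ℝ) := by
  ext i
  rw [flipLast_apply]
  by_cases hij : i = j
  · subst hij; simp
  · simp [hij]

theorem norm_sub_flipLast {d : ℕ} (x : E (d + 1)) :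
    ‖x - flipLast d x‖ = 2 * |x (Fin.last d)| := by
  have : x - flipLast d x = EuclideanSpace.single (Fin.last d) (2 * x (Fin.last d)) := by
    ext i
    refine Fin.lastCases ?_ (fun k => ?_) i
    · simp [flipLast_apply]; ring
    · simp [flipLast_apply, Fin.castSucc_ne_last]
  rw [this, PiLp.norm_single, Real.norm_eq_abs, abs_mul]
  norm_num

theorem ae_last_ne_zero (d : ℕ) : ∀ᵐ x : E (d + 1), x (Fin.last d) ≠ 0 := by
  let K : Submodule ℝ (E (d + 1)) :=
    LinearMap.ker (EuclideanSpace.proj (𝕜 := ℝ) (Fin.last d) : E (d + 1) →L[ℝ] ℝ).toLinearMap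
  have hK : K ≠ ⊤ := by
    intro h
    have : EuclideanSpace.single (Fin.last d) (1 : ℝ) ∈ K := h ▸ Submodule.mem_top
    simp [K] at this
  have := Measure.addHaar_submodule (volume : Measure (E (d + 1))) K hK
  rw [ae_iff]
  convert this using 2
  ext x
  simp [K]

/-- The half-space on the side `σ = ±1` of the hyperplane where the last coordinate vanishes. -/
def halfSpace (d : ℕ) (σ : ℝ) : Set (E (d + 1)) := {x | 0 < σ * x (Fin.last d)}

theorem measurableSet_halfSpace (d : ℕ) (σ : ℝ) : MeasurableSet (halfSpace d σ) := by
  have hm : Measurable fun x : E (d + 1) => σ * x (Fin.last d) := by fun_prop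
  exact hm measurableSet_Ioi

theorem flipLast_mem_halfSpace {d : ℕ} {σ : ℝ} (hσ : σ ≠ 0) {x : E (d + 1)}
    (hx : x (Fin.last d) ≠ 0) : flipLast d x ∈ halfSpace d σ ↔ x ∉ halfSpace d σ := by
  have h0 : σ * x (Fin.last d) ≠ 0 := mul_ne_zero hσ hx
  simp only [halfSpace, Set.mem_ofPred_eq, flipLast_apply, flipSign_last, not_lt]
  constructor
  · intro h; linarith
  · intro h; have := lt_of_le_of_ne h h0; linarith

/-- The reflection preserves volume and exchanges the two half-spaces up to the null hyperplane
between them. -/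
theorem integral_eq_integral_halfSpace {d : ℕ} {σ : ℝ} (hσ : σ ≠ 0) {g : E (d + 1) → ℝ}
    (hg : Integrable g) :
    ∫ x, g x = ∫ x, (halfSpace d σ).indicator (fun x => g x + g (flipLast d x)) x := by
  have hmp := (flipLast d).measurePreserving
  have hH := measurableSet_halfSpace d σ
  have h1 : ∫ x, g x = (∫ x, (halfSpace d σ).indicator g x) +
      ∫ x, (halfSpace d σ)ᶜ.indicator g x := by
    rw [integral_indicator hH, integral_indicator hH.compl, integral_add_compl hH hg]
  have h2 : ∫ x, (halfSpace d σ)ᶜ.indicator g x =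
      ∫ x, (halfSpace d σ).indicator (fun x => g (flipLast d x)) x := by
    rw [← hmp.integral_comp (flipLast d).toHomeomorph.measurableEmbedding]
    refine integral_congr_ae ?_
    filter_upwards [ae_last_ne_zero d] with x hx
    have := flipLast_mem_halfSpace hσ hx
    by_cases hxH : x ∈ halfSpace d σ
    · rw [Set.indicator_of_mem hxH, Set.indicator_of_mem]
      exact fun h => (this.1 h) hxH
    · rw [Set.indicator_of_notMem hxH, Set.indicator_of_notMem]
      exact fun h => h (this.2 hxH)
  have hgf : Integrable fun x => g (flipLast d x) :=
    hmp.integrable_comp_of_integrable hg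
  rw [h1, h2, ← integral_add (hg.indicator hH) (hgf.indicator hH)]
  refine integral_congr_ae (ae_of_all _ fun x => ?_)
  by_cases hxH : x ∈ halfSpace d σ <;> simp [hxH]

theorem deriv_smoothTransition_of_neg {r : ℝ} (hr : r < 0) : deriv Real.smoothTransition r = 0 := by
  have : Real.smoothTransition =ᶠ[𝓝 r] fun _ => (0 : ℝ) := by
    filter_upwards [Iio_mem_nhds hr] with s hs
    exact Real.smoothTransition.zero_of_nonpos (le_of_lt hs)
  rw [this.deriv_eq, deriv_const]

theorem deriv_smoothTransition_of_one_lt {r : ℝ} (hr : 1 < r) :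
    deriv Real.smoothTransition r = 0 := by
  have : Real.smoothTransition =ᶠ[𝓝 r] fun _ => (1 : ℝ) := by
    filter_upwards [Ioi_mem_nhds hr] with s hs
    exact Real.smoothTransition.one_of_one_le (le_of_lt hs)
  rw [this.deriv_eq, deriv_const]

/-- Scale-invariant form of the cut-off estimate: after rescaling by `n`, the derivative times the
distance to the hyperplane stays bounded uniformly in `n`. -/
theorem exists_abs_mul_deriv_smoothTransition_le :
    ∃ K : ℝ, ∀ r : ℝ, |r * deriv Real.smoothTransition r| ≤ K := by
  have hc : Continuous (deriv Real.smoothTransition) :=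
    (Real.smoothTransition.contDiff (n := 1)).continuous_deriv le_rfl
  obtain ⟨K, hK⟩ := (isCompact_Icc (a := (0 : ℝ)) (b := 1)).exists_bound_of_continuousOn
    (continuous_id.mul hc).continuousOn
  have hK0 : 0 ≤ K := (norm_nonneg _).trans (hK 0 (by simp))
  refine ⟨K, fun r => ?_⟩
  rcases lt_or_ge r 0 with h | h
  · simpa [deriv_smoothTransition_of_neg h] using hK0
  rcases lt_or_ge 1 r with h' | h'
  · simpa [deriv_smoothTransition_of_one_lt h'] using hK0
  · exact hK r ⟨h, h'⟩

/-- Weak derivatives of the function that is even in the last variable and agrees with `u` on a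
half-space. -/
theorem HasWeakDeriv.fold {d : ℕ} {σ : ℝ} (hσ : σ = 1 ∨ σ = -1) {Ω Ω' : Set (E (d + 1))}
    (hΩ : ∀ x ∈ Ω', 0 ≤ σ * x (Fin.last d) → x ∈ Ω)
    (hΩ' : ∀ x ∈ Ω', σ * x (Fin.last d) ≤ 0 → flipLast d x ∈ Ω) {j : Fin (d + 1)}
    {u g : E (d + 1) → ℝ} (hu : Integrable u) (hg : Integrable g) (h : HasWeakDeriv Ω j u g)
    [DecidablePred (· ∈ halfSpace d σ)] :
    HasWeakDeriv Ω' j ((halfSpace d σ).piecewise u fun x => u (flipLast d x))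
      ((halfSpace d σ).piecewise g fun x => flipSign j * g (flipLast d x)) := by
  intro ψ hψ hψc hψs
  have hσ0 : σ ≠ 0 := by rcases hσ with rfl | rfl <;> norm_num
  have hσ1 : |σ| = 1 := by rcases hσ with rfl | rfl <;> norm_num
  have hH := measurableSet_halfSpace d σ
  have hmp := (flipLast d).measurePreserving
  have huf : Integrable fun x => u (flipLast d x) := hmp.integrable_comp_of_integrable hu
  have hgf : Integrable fun x => flipSign j * g (flipLast d x) :=
    (hmp.integrable_comp_of_integrable hg).const_mul _
  let D : E (d + 1) → ℝ := fun x => fderiv ℝ ψ x (EuclideanSpace.single j 1)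
  let s : ℝ := flipSign j
  -- Folding the integrals onto the half-space replaces `ψ` by `Ψ`. In the normal direction `s =
  -- -1`, so `Ψ` vanishes on the hyperplane and no jump term appears.
  let Ψ : E (d + 1) → ℝ := fun x => ψ x + s * ψ (flipLast d x)
  have hψd : Differentiable ℝ ψ := hψ.differentiable (by simp)
  have hDcont : Continuous D := (hψ.continuous_fderiv (by simp)).clm_apply continuous_const
  obtain ⟨C, hC⟩ := hψ.lipschitzWith_of_hasCompactSupport hψc (by simp)
  have hDC : ∀ x, |D x| ≤ C := fun x => by
    have := (fderiv ℝ ψ x).le_opNorm (EuclideanSpace.single j 1)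
    simp only [PiLp.norm_single, norm_one, mul_one] at this
    exact this.trans (norm_fderiv_le_of_lipschitz ℝ hC)
  have hΨ : ContDiff ℝ ∞ Ψ :=
    hψ.add (contDiff_const.mul (hψ.comp (flipLast d).contDiff))
  obtain ⟨c, hc⟩ := hψc.exists_bound_of_continuous hψ.continuous
  have hΨc : ∀ x, |Ψ x| ≤ 2 * c := fun x => by
    have h1 := hc x
    have h2 := hc (flipLast d x)
    rw [Real.norm_eq_abs] at h1 h2
    calc |Ψ x| ≤ |ψ x| + |s * ψ (flipLast d x)| := abs_add_le _ _
      _ = |ψ x| + |ψ (flipLast d x)| := by rw [abs_mul, abs_flipSign, one_mul]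
      _ ≤ 2 * c := by linarith
  have hΨD : ∀ x, fderiv ℝ Ψ x (EuclideanSpace.single j 1) = D x + D (flipLast d x) := fun x => by
    have h1 : HasFDerivAt Ψ (fderiv ℝ ψ x + s • (fderiv ℝ ψ (flipLast d x)).comp
        ((flipLast d).toContinuousLinearEquiv : E (d + 1) →L[ℝ] E (d + 1))) x :=
      (hψd x).hasFDerivAt.add (((hψd _).hasFDerivAt.comp x
        (flipLast d).toContinuousLinearEquiv.hasFDerivAt).const_mul s)
    rw [h1.fderiv]
    simp [D, flipLast_single, ← mul_assoc, s, flipSign_mul_self]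
  -- `Ψ` need not vanish outside the half-space, so it is multiplied by smooth cut-offs tending to
  -- the indicator of the half-space.
  let χ : ℕ → E (d + 1) → ℝ := fun n x => Real.smoothTransition (n * (σ * x (Fin.last d)))
  have hχ : ∀ n, ContDiff ℝ ∞ (χ n) := fun n => by
    refine Real.smoothTransition.contDiff.comp ?_
    fun_prop
  have hχ01 : ∀ n x, |χ n x| ≤ 1 := fun n x =>
    abs_le.2 ⟨by linarith [Real.smoothTransition.nonneg (n * (σ * x (Fin.last d)))],
      Real.smoothTransition.le_one _⟩
  let δ : ℕ → E (d + 1) → ℝ := fun n x => fderiv ℝ (χ n) x (EuclideanSpace.single j 1)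
  have hδ : ∀ n x, δ n x = deriv Real.smoothTransition (n * (σ * x (Fin.last d))) *
      (n * (σ * (EuclideanSpace.single j (1 : ℝ) : E (d + 1)) (Fin.last d))) := fun n x => by
    have h1 : HasFDerivAt (fun x : E (d + 1) => (n : ℝ) * (σ * x (Fin.last d)))
        ((n : ℝ) • σ • (EuclideanSpace.proj (𝕜 := ℝ) (Fin.last d) : E (d + 1) →L[ℝ] ℝ)) x :=
      (((EuclideanSpace.proj (𝕜 := ℝ) (Fin.last d) :
        E (d + 1) →L[ℝ] ℝ).hasFDerivAt).const_mul σ).const_mul (n : ℝ)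
    have h2 := ((Real.smoothTransition.contDiff (n := 1)).differentiable
      (by simp) (n * (σ * x (Fin.last d)))).hasDerivAt.comp_hasFDerivAt x h1
    change fderiv ℝ (χ n) x _ = _
    rw [show χ n = Real.smoothTransition ∘ fun x : E (d + 1) => (n : ℝ) * (σ * x (Fin.last d))
      from rfl, h2.fderiv]
    simp
  obtain ⟨K, hK⟩ := exists_abs_mul_deriv_smoothTransition_le
  -- In the normal direction the factor `n` in `δ n` is absorbed by the Lipschitz bound of `Ψ` by a
  -- multiple of the distance to the hyperplane; in tangential directions `δ n` is zero.
  have hΨδ : ∀ n x, |Ψ x * δ n x| ≤ 2 * C * K := fun n x => by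
    have hK0 : 0 ≤ K := (abs_nonneg _).trans (hK 0)
    have hCK : 0 ≤ 2 * C * K := by positivity
    by_cases hj : j = Fin.last d
    · have hΨx : |Ψ x| ≤ C * (2 * |x (Fin.last d)|) := by
        have h1 := hC.dist_le_mul x (flipLast d x)
        rw [dist_eq_norm x, norm_sub_flipLast, Real.dist_eq] at h1
        simpa [Ψ, s, hj, sub_eq_add_neg] using h1
      have hKx := hK (n * (σ * x (Fin.last d)))
      rw [hδ, hj]
      simp only [PiLp.single_apply, if_true, mul_one]
      rw [abs_mul, abs_mul, abs_mul, hσ1]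
      rw [abs_mul, abs_mul, abs_mul, hσ1] at hKx
      calc _ ≤ C * (2 * |x (Fin.last d)|) * _ :=
            mul_le_mul_of_nonneg_right hΨx (by positivity)
        _ = 2 * C * (|(n : ℝ)| * (1 * |x (Fin.last d)|) *
            |deriv Real.smoothTransition (n * (σ * x (Fin.last d)))|) := by ring
        _ ≤ _ := mul_le_mul_of_nonneg_left hKx (by positivity)
    · have : (EuclideanSpace.single j (1 : ℝ) : E (d + 1)) (Fin.last d) = 0 := by
        simp [Ne.symm hj]
      rw [hδ, this]
      simpa using hCK
  have hprod : ∀ n x, fderiv ℝ (fun x => χ n x * Ψ x) x (EuclideanSpace.single j 1) =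
      χ n x * (D x + D (flipLast d x)) + Ψ x * δ n x := fun n x => by
    have h1 := (((hχ n).differentiable (by simp) x).hasFDerivAt).mul
      ((hΨ.differentiable (by simp) x).hasFDerivAt)
    rw [show (fun x => χ n x * Ψ x) = χ n * Ψ from rfl, h1.fderiv]
    simp [hΨD, δ]
  have hpos : ∀ n, tsupport (χ n) ⊆ {x | 0 ≤ σ * x (Fin.last d)} := fun n => by
    refine closure_minimal (fun x hx => ?_) (isClosed_le continuous_const (by fun_prop))
    by_contra hneg
    refine hx (Real.smoothTransition.zero_of_nonpos ?_)
    simp only [Set.mem_ofPred_eq, not_le] at hneg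
    exact mul_nonpos_of_nonneg_of_nonpos n.cast_nonneg hneg.le
  have hcf : HasCompactSupport (ψ ∘ flipLast d) :=
    hψc.comp_homeomorph (flipLast d).toHomeomorph
  have hΨcs : HasCompactSupport Ψ := hψc.add hcf.mul_left
  have hΨs : tsupport Ψ ⊆ tsupport ψ ∪ flipLast d ⁻¹' tsupport ψ := by
    refine closure_minimal (fun x hx => ?_) ((isClosed_tsupport ψ).union
      ((isClosed_tsupport ψ).preimage (flipLast d).continuous))
    by_contra hn
    simp only [Set.mem_union, Set.mem_preimage, not_or] at hn
    exact hx (by simp [Ψ, image_eq_zero_of_notMem_tsupport hn.1,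
      image_eq_zero_of_notMem_tsupport hn.2])
  have hgreen : ∀ n, ∫ x, u x * (χ n x * (D x + D (flipLast d x)) + Ψ x * δ n x) =
      - ∫ x, g x * (χ n x * Ψ x) := fun n => by
    have := h (fun x => χ n x * Ψ x) ((hχ n).mul hΨ) hΨcs.mul_left ?_
    · simpa only [hprod] using this
    -- The product is supported in the closed half-space, where a point of the support of `ψ` or its
    -- mirror image lies in `Ω'`; both cases lead back to `Ω`.
    · intro x hx
      have hxχ := hpos n (tsupport_mul_subset_left hx)
      rcases hΨs (tsupport_mul_subset_right hx) with hx' | hx'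
      · exact hΩ x (hψs hx') hxχ
      · have := hΩ' _ (hψs hx') (by
          rw [flipLast_apply, flipSign_last]
          simp only [Set.mem_ofPred_eq] at hxχ
          linarith)
        rwa [flipLast_flipLast] at this
  -- Off the hyperplane the cut-offs are eventually constant near each point, so the term with `δ n`
  -- disappears in the limit by dominated convergence.
  have hχlim : ∀ᵐ x : E (d + 1), (∀ᶠ n in atTop, χ n x = (halfSpace d σ).indicator 1 x) ∧
      ∀ᶠ n in atTop, δ n x = 0 := by
    filter_upwards [ae_last_ne_zero d] with x hx
    rcases lt_or_gt_of_ne (mul_ne_zero hσ0 hx) with hneg | hpos'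
    · have hnot : x ∉ halfSpace d σ := fun hx' => lt_asymm hneg hx'
      constructor
      · filter_upwards with n
        rw [Set.indicator_of_notMem hnot]
        exact Real.smoothTransition.zero_of_nonpos
          (mul_nonpos_of_nonneg_of_nonpos n.cast_nonneg hneg.le)
      · filter_upwards [eventually_ge_atTop 1] with n hn
        have hn' : (0 : ℝ) < n := by exact_mod_cast hn
        rw [hδ, deriv_smoothTransition_of_neg (mul_neg_of_pos_of_neg hn' hneg), zero_mul]
    · have hev : ∀ᶠ n : ℕ in atTop, 1 < (n : ℝ) * (σ * x (Fin.last d)) :=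
        (tendsto_natCast_atTop_atTop.atTop_mul_const hpos').eventually_gt_atTop 1
      constructor
      · filter_upwards [hev] with n hn
        rw [Set.indicator_of_mem (show x ∈ halfSpace d σ from hpos')]
        exact Real.smoothTransition.one_of_one_le hn.le
      · filter_upwards [hev] with n hn
        rw [hδ, deriv_smoothTransition_of_one_lt hn, zero_mul]
  have hDfcont : Continuous fun x => D (flipLast d x) := hDcont.comp (flipLast d).continuous
  have hδcont : ∀ n, Continuous (δ n) := fun n =>
    ((hχ n).continuous_fderiv (by simp)).clm_apply continuous_const
  have lim1 : Tendsto (fun n => ∫ x, u x * (χ n x * (D x + D (flipLast d x)) + Ψ x * δ n x)) atTop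
      (𝓝 (∫ x, u x * ((halfSpace d σ).indicator 1 x * (D x + D (flipLast d x))))) := by
    refine tendsto_integral_of_dominated_convergence (fun x => |u x| * (2 * C + 2 * C * K))
      (fun n => hu.aestronglyMeasurable.mul ?_) (hu.abs.mul_const _)
      (fun n => ae_of_all _ fun x => ?_) ?_
    · exact (((hχ n).continuous.mul (hDcont.add hDfcont)).add
        (hΨ.continuous.mul (hδcont n))).aestronglyMeasurable
    · rw [Real.norm_eq_abs, abs_mul]
      refine mul_le_mul_of_nonneg_left ((abs_add_le _ _).trans (add_le_add ?_ (hΨδ n x)))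
        (abs_nonneg _)
      rw [abs_mul]
      calc |χ n x| * |D x + D (flipLast d x)| ≤ 1 * (C + C) :=
            mul_le_mul (hχ01 n x) ((abs_add_le _ _).trans (add_le_add (hDC _) (hDC _)))
              (abs_nonneg _) zero_le_one
        _ = 2 * C := by ring
    · filter_upwards [hχlim] with x hx
      refine tendsto_const_nhds.congr' ?_
      filter_upwards [hx.1, hx.2] with n h1 h2
      rw [h1, h2, mul_zero, add_zero]
  have lim2 : Tendsto (fun n => ∫ x, g x * (χ n x * Ψ x)) atTop
      (𝓝 (∫ x, g x * ((halfSpace d σ).indicator 1 x * Ψ x))) := by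
    refine tendsto_integral_of_dominated_convergence (fun x => |g x| * (2 * c))
      (fun n => hg.aestronglyMeasurable.mul
        ((hχ n).continuous.mul hΨ.continuous).aestronglyMeasurable) (hg.abs.mul_const _)
      (fun n => ae_of_all _ fun x => ?_) ?_
    · rw [Real.norm_eq_abs, abs_mul, abs_mul]
      refine mul_le_mul_of_nonneg_left ?_ (abs_nonneg _)
      calc |χ n x| * |Ψ x| ≤ 1 * (2 * c) :=
            mul_le_mul (hχ01 n x) (hΨc x) (abs_nonneg _) zero_le_one
        _ = 2 * c := one_mul _
    · filter_upwards [hχlim] with x hx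
      refine tendsto_const_nhds.congr' ?_
      filter_upwards [hx.1] with n h1
      rw [h1]
  have hlim := tendsto_nhds_unique (lim1.congr hgreen) lim2.neg
  have hmemf : ∀ x ∈ halfSpace d σ, flipLast d x ∉ halfSpace d σ := fun x hx hx' => by
    simp only [halfSpace, Set.mem_ofPred_eq, flipLast_apply, flipSign_last] at hx hx'
    linarith
  have hui : Integrable fun x => (halfSpace d σ).piecewise u (fun x => u (flipLast d x)) x * D x :=
    (Integrable.piecewise hH hu.integrableOn huf.integrableOn).mul_bdd
      hDcont.aestronglyMeasurable (ae_of_all _ hDC)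
  have hgi : Integrable fun x => (halfSpace d σ).piecewise g
      (fun x => flipSign j * g (flipLast d x)) x * ψ x :=
    (Integrable.piecewise hH hg.integrableOn hgf.integrableOn).mul_bdd
      hψ.continuous.aestronglyMeasurable (ae_of_all _ hc)
  have e1 := integral_eq_integral_halfSpace hσ0 hui
  have e2 := integral_eq_integral_halfSpace hσ0 hgi
  change ∫ x, _ * D x = _
  rw [e1, e2]
  convert hlim using 1
  · refine integral_congr_ae (ae_of_all _ fun x => ?_)
    by_cases hx : x ∈ halfSpace d σ
    · simp [hx, hmemf x hx, flipLast_flipLast, mul_add]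
    · simp [hx]
  · congr 1
    refine integral_congr_ae (ae_of_all _ fun x => ?_)
    by_cases hx : x ∈ halfSpace d σ
    · simp [hx, hmemf x hx, flipLast_flipLast, Ψ, s]; ring
    · simp [hx]

theorem HasWeakDeriv.translate {n : ℕ} {Ω Ω' : Set (E n)} {j : Fin n} {u g : E n → ℝ}
    (h : HasWeakDeriv Ω j u g) (a : E n) (hΩ : ∀ x ∈ Ω', x - a ∈ Ω) :
    HasWeakDeriv Ω' j (fun x => u (x - a)) fun x => g (x - a) := by
  intro ψ hψ hψc hψs
  have key := h (fun x => ψ (x + a)) (hψ.comp (contDiff_id.add contDiff_const))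
    (hψc.comp_homeomorph (Homeomorph.addRight a)) (by
      intro x hx
      have : x + a ∈ tsupport ψ := tsupport_comp_subset_preimage ψ (continuous_add_const a) hx
      simpa using hΩ _ (hψs this))
  simp only [fderiv_comp_add_right] at key
  rw [← integral_sub_right_eq_self _ a, ← integral_sub_right_eq_self (fun x => g x * _) a] at key
  simpa using key

/-! ### Sobolev functions on the infinite strip -/

/-- `u` and `G` are in `L¹ ∩ L^p`, and `G` is the weak gradient of `u` on `ℝ^d × (-h, h)`. -/
structure IsStripSobolev {d m : ℕ} (p h : ℝ) (u : E (d + 1) → Fin m → ℝ)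
    (G : E (d + 1) → M m (d + 1)) : Prop where
  integrable : ∀ i, Integrable fun x => u x i
  memLp : ∀ i, MemLp (fun x => u x i) (ENNReal.ofReal p)
  integrable_grad : ∀ i j, Integrable fun x => G x i j
  memLp_grad : ∀ i j, MemLp (fun x => G x i j) (ENNReal.ofReal p)
  weakDeriv : ∀ i j, HasWeakDeriv (strip d h) j (fun x => u x i) fun x => G x i j

theorem indicator_apply_apply {X ι : Type*} {R : ι → Type*} [∀ i, Zero (R i)] (s : Set X)
    (u : X → ∀ i, R i) (x : X) (i : ι) : s.indicator u x i = s.indicator (fun x => u x i) x := by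
  by_cases hx : x ∈ s <;> simp [hx]

theorem indicator_matrix_apply {X : Type*} {m n : ℕ} (s : Set X) (G : X → M m n) (x : X)
    (i : Fin m) (j : Fin n) : s.indicator G x i j = s.indicator (fun x => G x i j) x := by
  by_cases hx : x ∈ s <;> simp [hx]

/-- Green's formula without lateral boundary term is exactly weak differentiability of the zero
extension. Integrability comes from `p > 1` on a box of finite volume. -/
theorem IsTestFunction.isStripSobolev {d m : ℕ} {p h S : ℝ} (hp : 1 < p) (hS : 0 < S)
    {u : E (d + 1) → Fin m → ℝ} {G : E (d + 1) → M m (d + 1)} (hu : IsTestFunction p h S u G) :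
    IsStripSobolev p h ((box d h S).indicator u) ((box d h S).indicator G) := by
  have hm := measurableSet_box d h S
  have : IsFiniteMeasure (volume.restrict (box d h S)) :=
    ⟨by simpa using (volume_box_ne_top d h hS).lt_top⟩
  have hp1 : (1 : ENNReal) ≤ ENNReal.ofReal p := by simpa using hp.le
  constructor
  · intro i
    simp only [indicator_apply_apply]
    exact (integrable_indicator_iff hm).2 ((hu.1.memLp i).integrable hp1)
  · intro i
    simp only [indicator_apply_apply]
    exact (memLp_indicator_iff_restrict hm).2 (hu.1.memLp i)
  · intro i j
    simp only [indicator_matrix_apply]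
    exact (integrable_indicator_iff hm).2 ((hu.1.memLp_grad i j).integrable hp1)
  · intro i j
    simp only [indicator_matrix_apply]
    exact (memLp_indicator_iff_restrict hm).2 (hu.1.memLp_grad i j)
  · intro i j ψ hψ hψc hψs
    have := hu.2 ψ hψ hψc hψs i j
    rw [← integral_indicator hm, ← integral_indicator hm] at this
    simpa only [indicator_apply_apply, indicator_matrix_apply, Set.indicator_mul_left] using this

theorem IsStripSobolev.isTestFunction {d m : ℕ} {p h T : ℝ} {u : E (d + 1) → Fin m → ℝ}
    {G : E (d + 1) → M m (d + 1)} (hu : IsStripSobolev p h u G)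
    (h0 : ∀ x ∈ strip d h, x ∉ box d h T → (∀ i, u x i = 0) ∧ ∀ i j, G x i j = 0) :
    IsTestFunction p h T u G := by
  have htrace : HasZeroLateralTrace h T u G := by
    intro ψ hψ hψc hψs i j
    have key := hu.weakDeriv i j ψ hψ hψc hψs
    rw [setIntegral_eq_integral_of_forall_compl_eq_zero,
      setIntegral_eq_integral_of_forall_compl_eq_zero, key]
    · intro x hx
      by_cases hxs : x ∈ strip d h
      · rw [(h0 x hxs hx).2, zero_mul]
      · rw [image_eq_zero_of_notMem_tsupport fun h' => hxs (hψs h'), mul_zero]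
    · intro x hx
      by_cases hxs : x ∈ strip d h
      · rw [(h0 x hxs hx).1, zero_mul]
      · have : fderiv ℝ ψ x = 0 := image_eq_zero_of_notMem_tsupport fun h' =>
          hxs (hψs (tsupport_fderiv_subset ℝ h'))
        simp [this]
  refine ⟨⟨fun i => (hu.memLp i).restrict _, fun i j => (hu.memLp_grad i j).restrict _,
    fun ψ hψ hψc hψs => htrace ψ hψ hψc (hψs.trans fun x hx => hx.2)⟩, htrace⟩

theorem IsStripSobolev.sum {d m : ℕ} {p h : ℝ} {ι : Type*} [Fintype ι]
    {u : ι → E (d + 1) → Fin m → ℝ} {G : ι → E (d + 1) → M m (d + 1)}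
    (hu : ∀ k, IsStripSobolev p h (u k) (G k)) :
    IsStripSobolev p h (fun x i => ∑ k, u k x i)
      (fun x => Matrix.of fun i j => ∑ k, G k x i j) := by
  refine ⟨fun i => integrable_finsetSum _ fun k _ => (hu k).integrable i,
    fun i => memLp_finsetSum _ fun k _ => (hu k).memLp i,
    fun i j => integrable_finsetSum _ fun k _ => (hu k).integrable_grad i j,
    fun i j => memLp_finsetSum _ fun k _ => (hu k).memLp_grad i j, ?_⟩
  intro i j ψ hψ hψc hψs
  obtain ⟨c, hc⟩ := hψc.exists_bound_of_continuous hψ.continuous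
  have hD : Continuous fun x => fderiv ℝ ψ x (EuclideanSpace.single j 1) :=
    (hψ.continuous_fderiv (by simp)).clm_apply continuous_const
  obtain ⟨C, hC⟩ :=
    (hψc.fderiv_apply (𝕜 := ℝ) (EuclideanSpace.single j 1)).exists_bound_of_continuous hD
  simp only [Matrix.of_apply, Finset.sum_mul]
  rw [integral_finsetSum, integral_finsetSum, ← Finset.sum_neg_distrib]
  · exact Finset.sum_congr rfl fun k _ => (hu k).weakDeriv i j ψ hψ hψc hψs
  · exact fun k _ => ((hu k).integrable_grad i j).mul_bdd hψ.continuous.aestronglyMeasurable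
      (ae_of_all _ hc)
  · exact fun k _ => ((hu k).integrable i).mul_bdd hD.aestronglyMeasurable (ae_of_all _ hC)

open Classical in
/-- The function `u`, made even about the hyperplane through `b` with normal the last coordinate
direction (keeping the values on the side `σ`), and translated by `a`. -/
noncomputable def foldFun {d m : ℕ} (σ : ℝ) (a b : E (d + 1)) (u : E (d + 1) → Fin m → ℝ) :
    E (d + 1) → Fin m → ℝ := fun x i =>
  (halfSpace d σ).piecewise (fun y => u (y + b) i) (fun y => u (flipLast d y + b) i) (x - (a + b))

open Classical in
/-- The weak gradient of `foldFun σ a b u` if `G` is the weak gradient of `u`. -/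
noncomputable def foldGrad {d m : ℕ} (σ : ℝ) (a b : E (d + 1)) (G : E (d + 1) → M m (d + 1)) :
    E (d + 1) → M m (d + 1) := fun x => Matrix.of fun i j =>
  (halfSpace d σ).piecewise (fun y => G (y + b) i j)
    (fun y => flipSign j * G (flipLast d y + b) i j) (x - (a + b))

/-- The height of the hyperplane about which a function is folded, at distance `t` from the
boundary of the strip `(-h, h)` on the side opposite to `σ`. -/
def foldPoint (d : ℕ) (σ h t : ℝ) : E (d + 1) := pair 0 (-(σ * (h - t)))

/-- Here `y` is a height in the strip and the fold sits at `z - σ (h - t)`, at distance `σ z + t ≤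
2t` from the face opposite to `σ`. Reflected heights therefore come from distances between `t` and
`t + 2t`, and `3t ≤ 2h` keeps them inside the strip. -/
theorem fold_geometry {σ h t z y : ℝ} (hσ : σ = 1 ∨ σ = -1) (ht : 0 < t) (hth : 3 * t ≤ 2 * h)
    (hz : 0 ≤ σ * z) (hzt : σ * z ≤ t) (hy : y ∈ Set.Ioo (-h) h) :
    (0 ≤ σ * (y - (z + -(σ * (h - t)))) → y - z ∈ Set.Ioo (-h) h) ∧
    (σ * (y - (z + -(σ * (h - t)))) ≤ 0 →
      -(y - (z + -(σ * (h - t)))) + -(σ * (h - t)) ∈ Set.Ioo (-h) h ∧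
      σ * (-(y - (z + -(σ * (h - t)))) + -(σ * (h - t))) + h ∈ Set.Ico t (3 * t)) := by
  obtain ⟨h1, h2⟩ := hy
  rcases hσ with rfl | rfl <;> refine ⟨fun h3 => ⟨?_, ?_⟩, fun h3 => ⟨⟨?_, ?_⟩, ?_, ?_⟩⟩ <;> linarith

theorem IsStripSobolev.fold {d m : ℕ} {p h σ t z : ℝ} (hσ : σ = 1 ∨ σ = -1)
    (ht : 0 < t) (hth : 3 * t ≤ 2 * h) (hz : 0 ≤ σ * z) (hzt : σ * z ≤ t) (τ : E d)
    {u : E (d + 1) → Fin m → ℝ} {G : E (d + 1) → M m (d + 1)} (hu : IsStripSobolev p h u G) :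
    IsStripSobolev p h (foldFun σ (pair τ z) (foldPoint d σ h t) u)
      (foldGrad σ (pair τ z) (foldPoint d σ h t) G) := by
  classical
  set b := foldPoint d σ h t with hb
  set a := pair τ z with ha
  have hH := measurableSet_halfSpace d σ
  have hmp := (flipLast d).measurePreserving
  have hmp₁ := measurePreserving_add_right (volume : Measure (E (d + 1))) b
  have hmp₂ := measurePreserving_sub_right (volume : Measure (E (d + 1))) (a + b)
  -- The factor `s` is the sign acquired by a derivative under reflection; `s = 1` gives the
  -- function itself.
  have hLp : ∀ (q : ENNReal) (s : ℝ) (v : E (d + 1) → ℝ), MemLp v q →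
      MemLp (fun x => (halfSpace d σ).piecewise (fun y => v (y + b))
        (fun y => s * v (flipLast d y + b)) (x - (a + b))) q := by
    intro q s v hv
    refine MemLp.comp_measurePreserving (g := (halfSpace d σ).piecewise (fun y => v (y + b))
        (fun y => s * v (flipLast d y + b))) ?_ hmp₂
    have h1 := hv.comp_measurePreserving hmp₁
    exact MemLp.piecewise hH (h1.restrict _)
      (((h1.comp_measurePreserving hmp).const_mul s).restrict _)
  have hLp' : ∀ (q : ENNReal) (v : E (d + 1) → ℝ), MemLp v q →
      MemLp (fun x => (halfSpace d σ).piecewise (fun y => v (y + b))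
        (fun y => v (flipLast d y + b)) (x - (a + b))) q := by
    intro q v hv
    simpa using hLp q 1 v hv
  refine ⟨fun i => memLp_one_iff_integrable.1
      (hLp' 1 _ (memLp_one_iff_integrable.2 (hu.integrable i))),
    fun i => hLp' _ _ (hu.memLp i),
    fun i j => memLp_one_iff_integrable.1
      (hLp 1 _ _ (memLp_one_iff_integrable.2 (hu.integrable_grad i j))),
    fun i j => hLp _ _ _ (hu.memLp_grad i j), fun i j => ?_⟩
  -- Translation by `b` moves the folding hyperplane to height zero, where the reflection lemma
  -- applies.
  have h1 : HasWeakDeriv {y | y + b ∈ strip d h} j (fun y => u (y + b) i)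
      fun y => G (y + b) i j := by
    have := (hu.weakDeriv i j).translate (Ω' := {y | y + b ∈ strip d h}) (-b) (fun x hx => by
      simpa using hx)
    simpa using this
  have hgeo : ∀ y ∈ {y : E (d + 1) | y + (a + b) ∈ strip d h}, _ := fun y hy =>
    fold_geometry hσ ht hth hz hzt (y := (y + (a + b)) (Fin.last d)) hy
  have hΩ : ∀ y ∈ {y : E (d + 1) | y + (a + b) ∈ strip d h}, 0 ≤ σ * y (Fin.last d) →
      y ∈ {y | y + b ∈ strip d h} := by
    intro y hy hpos
    have := (hgeo y hy).1 (by simpa [ha, hb, foldPoint] using hpos)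
    simp only [ha, hb, foldPoint, PiLp.add_apply, pair_last] at this
    simp only [strip, Set.mem_ofPred_eq, PiLp.add_apply, hb, foldPoint, pair_last]
    convert this using 1
    ring
  have hΩ' : ∀ y ∈ {y : E (d + 1) | y + (a + b) ∈ strip d h}, σ * y (Fin.last d) ≤ 0 →
      flipLast d y ∈ {y | y + b ∈ strip d h} := by
    intro y hy hneg
    have := ((hgeo y hy).2 (by simpa [ha, hb, foldPoint] using hneg)).1
    simp only [ha, hb, foldPoint, PiLp.add_apply, pair_last] at this
    simp only [strip, Set.mem_ofPred_eq, PiLp.add_apply, hb, foldPoint, pair_last,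
      flipLast_apply, flipSign_last]
    convert this using 1
    ring
  have h2 := h1.fold hσ hΩ hΩ' ((hu.integrable i).comp_add_right b)
    ((hu.integrable_grad i j).comp_add_right b)
  exact h2.translate (a + b) fun x hx => by simpa using hx

/-! ### The energy of folded copies of a test function -/

/-- Reflection changes only the sign of the last column, and the last column of `(A | 0)` is zero.
The growth bound is thus the same before and after reflection, although `f` itself need not be. -/
theorem matNorm_augment_add_flip {d m : ℕ} (A : M m d) {G G' : M m (d + 1)}
    (h : ∀ i j, G' i j = flipSign j * G i j) :
    matNorm (augment A 0 + G') = matNorm (augment A 0 + G) := by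
  unfold matNorm
  congr 1
  refine Finset.sum_congr rfl fun i _ => Finset.sum_congr rfl fun j _ => ?_
  refine Fin.lastCases ?_ (fun k => ?_) j
  · simp [h, augment]
  · simp [h]

/-- The image of a point under the reflection that underlies `foldFun`. -/
noncomputable def foldImage {d : ℕ} (a b x : E (d + 1)) : E (d + 1) := flipLast d (x - (a + b)) + b

section

variable {d m : ℕ} {σ h t z : ℝ} {τ : E d} {x : E (d + 1)} {G : E (d + 1) → M m (d + 1)}

theorem foldFun_of_mem {a b : E (d + 1)} {u : E (d + 1) → Fin m → ℝ}
    (hx : x - (a + b) ∈ halfSpace d σ) : foldFun σ a b u x = u (x - a) := by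
  funext i
  have : x - (a + b) + b = x - a := by abel
  simp [foldFun, hx, this]

theorem foldFun_of_notMem {a b : E (d + 1)} {u : E (d + 1) → Fin m → ℝ}
    (hx : x - (a + b) ∉ halfSpace d σ) : foldFun σ a b u x = u (foldImage a b x) := by
  funext i
  simp [foldFun, hx, foldImage]

theorem foldGrad_of_mem {a b : E (d + 1)} (hx : x - (a + b) ∈ halfSpace d σ) :
    foldGrad σ a b G x = G (x - a) := by
  ext i j
  have : x - (a + b) + b = x - a := by abel
  simp [foldGrad, hx, this]

theorem foldGrad_of_notMem {a b : E (d + 1)} (hx : x - (a + b) ∉ halfSpace d σ) (i : Fin m)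
    (j : Fin (d + 1)) : foldGrad σ a b G x i j = flipSign j * G (foldImage a b x) i j := by
  simp [foldGrad, hx, foldImage]

theorem foldImage_castSucc (i : Fin d) :
    foldImage (pair τ z) (foldPoint d σ h t) x i.castSucc = x i.castSucc - τ i := by
  simp [foldImage, flipLast_apply, foldPoint]

theorem foldImage_last : foldImage (pair τ z) (foldPoint d σ h t) x (Fin.last d) =
    -(x (Fin.last d) - (z + -(σ * (h - t)))) + -(σ * (h - t)) := by
  simp only [foldImage, flipLast_apply, foldPoint, PiLp.add_apply, PiLp.sub_apply, pair_last,
    flipSign_last]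
  ring

theorem mem_halfSpace_fold : x - (pair τ z + foldPoint d σ h t) ∈ halfSpace d σ ↔
    0 < σ * (x (Fin.last d) - (z + -(σ * (h - t)))) := by
  simp [halfSpace, foldPoint]

/-- The translate of `box d h S` in the film directions by `τ`. -/
def cell (d : ℕ) (h S : ℝ) (τ : E d) : Set (E (d + 1)) := {x | x - pair τ 0 ∈ box d h S}

theorem mem_cell {S : ℝ} : x ∈ cell d h S τ ↔
    (∀ i : Fin d, x i.castSucc - τ i ∈ Set.Ioo 0 S) ∧ x (Fin.last d) ∈ Set.Ioo (-h) h := by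
  simp [cell, box]

/-- Neither the vertical shift nor the reflection affects the film coordinates, apart from the
translation by `τ`. The restriction to the strip is needed: the shifted copy may be nonzero beyond a
face. -/
theorem fold_eq_zero {S : ℝ} {u : E (d + 1) → Fin m → ℝ} (hu : ∀ y ∉ box d h S, u y = 0)
    (hG : ∀ y ∉ box d h S, G y = 0) (hx : x ∈ strip d h) (hxc : x ∉ cell d h S τ) :
    foldFun σ (pair τ z) (foldPoint d σ h t) u x = 0 ∧
      foldGrad σ (pair τ z) (foldPoint d σ h t) G x = 0 := by
  have h1 : x - pair τ z ∉ box d h S := fun h' => hxc (mem_cell.2 ⟨fun i => by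
    simpa using h'.1 i, hx⟩)
  have h2 : foldImage (pair τ z) (foldPoint d σ h t) x ∉ box d h S :=
    fun h' => hxc (mem_cell.2 ⟨fun i => by simpa only [foldImage_castSucc] using h'.1 i, hx⟩)
  by_cases hm : x - (pair τ z + foldPoint d σ h t) ∈ halfSpace d σ
  · rw [foldFun_of_mem hm, foldGrad_of_mem hm, hu _ h1, hG _ h1]
    exact ⟨rfl, rfl⟩
  · refine ⟨by rw [foldFun_of_notMem hm, hu _ h2], ?_⟩
    ext i j
    rw [foldGrad_of_notMem hm, hG _ h2]
    simp

/-- The layer of points of the strip at distance between `t` and `3 t` from the boundary on the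
side opposite to `σ`. -/
def layer (d : ℕ) (σ h t : ℝ) : Set (E (d + 1)) :=
  {x | σ * x (Fin.last d) + h ∈ Set.Ico t (3 * t)}

theorem measurableSet_layer (d : ℕ) (σ h t : ℝ) : MeasurableSet (layer d σ h t) := by
  have hm : Measurable fun x : E (d + 1) => σ * x (Fin.last d) + h := by fun_prop
  exact hm measurableSet_Ico

/-- On the kept side the first term dominates by almost periodicity; on the reflected side the
second dominates by growth, the reflected point lying in the layer. Both terms are nonnegative, so
their sum serves in either case. -/
theorem energy_fold_le {p α β η S : ℝ} {f : E (d + 1) → M m (d + 1) → ℝ} (hα : 0 < α)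
    (hg : HasPGrowth p α β f) (hβ : 0 < β) (hη : 0 ≤ η) (hσ : σ = 1 ∨ σ = -1) (ht : 0 < t)
    (hth : 3 * t ≤ 2 * h) (hz : 0 ≤ σ * z) (hzt : σ * z ≤ t)
    (hf : ∀ x B, |f (x + pair τ z) B - f x B| ≤ η * growthWeight p B) (A : M m d)
    (hx : x ∈ cell d h S τ) :
    f x (augment A 0 +
      foldGrad σ (pair τ z) (foldPoint d σ h t) ((box d h S).indicator G) x) ≤
    (box d h S).indicator (fun y => f y (augment A 0 + G y) +
      η * growthWeight p (augment A 0 + G y)) (x - pair τ z) +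
    (box d h S ∩ layer d σ h t).indicator (fun y => β * growthWeight p (augment A 0 + G y))
      (foldImage (pair τ z) (foldPoint d σ h t) x) := by
  obtain ⟨hx₁, hx₂⟩ := mem_cell.1 hx
  have hgeo := fold_geometry hσ ht hth hz hzt hx₂
  by_cases hm : x - (pair τ z + foldPoint d σ h t) ∈ halfSpace d σ
  · have hy : x - pair τ z ∈ box d h S :=
      ⟨fun i => by simpa using hx₁ i, by simpa using hgeo.1 (mem_halfSpace_fold.1 hm).le⟩
    rw [foldGrad_of_mem hm, Set.indicator_of_mem hy, Set.indicator_of_mem hy]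
    have h1 := hf (x - pair τ z) (augment A 0 + G (x - pair τ z))
    rw [sub_add_cancel] at h1
    have h2 := (abs_le.1 h1).2
    have h3 : 0 ≤ (box d h S ∩ layer d σ h t).indicator
        (fun y => β * growthWeight p (augment A 0 + G y))
        (foldImage (pair τ z) (foldPoint d σ h t) x) :=
      Set.indicator_nonneg (fun y _ => mul_nonneg hβ.le (growthWeight_pos _ _).le) _
    linarith
  · have hneg := hgeo.2 (not_lt.1 fun h' => hm (mem_halfSpace_fold.2 h'))
    have hy : foldImage (pair τ z) (foldPoint d σ h t) x ∈ box d h S :=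
      ⟨fun i => by simpa only [foldImage_castSucc] using hx₁ i,
        by simpa only [foldImage_last] using hneg.1⟩
    have hyl : foldImage (pair τ z) (foldPoint d σ h t) x ∈ layer d σ h t := by
      simp only [layer, Set.mem_ofPred_eq, foldImage_last]
      exact hneg.2
    rw [Set.indicator_of_mem (show _ ∈ box d h S ∩ layer d σ h t from ⟨hy, hyl⟩)]
    have h1 := (hg x (augment A 0 +
      foldGrad σ (pair τ z) (foldPoint d σ h t) ((box d h S).indicator G) x)).2
    rw [matNorm_augment_add_flip A (foldGrad_of_notMem hm), Set.indicator_of_mem hy] at h1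
    have h3 : 0 ≤ (box d h S).indicator (fun y => f y (augment A 0 + G y) +
        η * growthWeight p (augment A 0 + G y)) (x - pair τ z) :=
      Set.indicator_nonneg (fun y _ => add_nonneg (hg.nonneg hα _ _)
        (mul_nonneg hη (growthWeight_pos _ _).le)) _
    exact h1.trans (le_add_of_nonneg_left h3)

theorem integrable_comp_foldImage {g : E (d + 1) → ℝ} (hg : Integrable g) (a b : E (d + 1)) :
    Integrable fun x => g (foldImage a b x) :=
  ((flipLast d).measurePreserving.integrable_comp_of_integrable
    (hg.comp_add_right b)).comp_sub_right (a + b)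

theorem integral_comp_foldImage (g : E (d + 1) → ℝ) (a b : E (d + 1)) :
    ∫ x, g (foldImage a b x) = ∫ x, g x := by
  unfold foldImage
  rw [integral_sub_right_eq_self (fun x => g (flipLast d x + b)) (a + b),
    (flipLast d).measurePreserving.integral_comp
      (flipLast d).toHomeomorph.measurableEmbedding (fun x => g (x + b)),
    integral_add_right_eq_self]

end

/-- Gluing folded copies of a test function on disjoint cells. -/
theorem exists_testFunction_glued {d m : ℕ} {p h α β η S T : ℝ} (hp : 1 < p) (hh : 0 < h)
    (hα : 0 < α) (hβ : 0 < β) (hη : 0 ≤ η) (hS : 0 < S) (hT : 0 < T)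
    {f : E (d + 1) → M m (d + 1) → ℝ} (hf : IsCaratheodory f) (hg : HasPGrowth p α β f)
    (A : M m d) {u : E (d + 1) → Fin m → ℝ} {G : E (d + 1) → M m (d + 1)}
    (hu : IsTestFunction p h S u G) {ι : Type*} [Fintype ι] {τ : ι → E d} {z σ t : ι → ℝ}
    {κ : ℝ} (hσ : ∀ k, σ k = 1 ∨ σ k = -1) (ht : ∀ k, 0 < t k) (hth : ∀ k, 3 * t k ≤ 2 * h)
    (hz : ∀ k, 0 ≤ σ k * z k) (hzt : ∀ k, σ k * z k ≤ t k)
    (hap : ∀ k x B, |f (x + pair (τ k) (z k)) B - f x B| ≤ η * growthWeight p B)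
    (hlayer : ∀ k, ∫ x in box d h S ∩ layer d (σ k) h (t k),
      growthWeight p (augment A 0 + G x) ≤ κ)
    (hsub : ∀ k, cell d h S (τ k) ⊆ box d h T)
    (hdisj : ∀ k l, k ≠ l → Disjoint (cell d h S (τ k)) (cell d h S (τ l))) :
    ∃ (v : E (d + 1) → Fin m → ℝ) (H : E (d + 1) → M m (d + 1)), IsTestFunction p h T v H ∧
      ∫ x in box d h T, f x (augment A 0 + H x) ≤
        Fintype.card ι * ((∫ x in box d h S, f x (augment A 0 + G x)) +
          η * (∫ x in box d h S, growthWeight p (augment A 0 + G x)) + β * κ) +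
        β * growthWeight p (augment A 0) * (2 * h * T ^ d - Fintype.card ι * (2 * h * S ^ d)) := by
  classical
  set B := augment A 0 with hB
  have hmS := measurableSet_box d h S
  have hmT := measurableSet_box d h T
  let U := (box d h S).indicator u
  let Γ := (box d h S).indicator G
  have hU0 : ∀ y ∉ box d h S, U y = 0 := fun y hy => Set.indicator_of_notMem hy _
  have hΓ0 : ∀ y ∉ box d h S, Γ y = 0 := fun y hy => Set.indicator_of_notMem hy _
  let v : ι → E (d + 1) → Fin m → ℝ := fun k =>
    foldFun (σ k) (pair (τ k) (z k)) (foldPoint d (σ k) h (t k)) U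
  let V : ι → E (d + 1) → M m (d + 1) := fun k =>
    foldGrad (σ k) (pair (τ k) (z k)) (foldPoint d (σ k) h (t k)) Γ
  have hzero : ∀ k, ∀ x ∈ strip d h, x ∉ cell d h S (τ k) → v k x = 0 ∧ V k x = 0 :=
    fun k x hx hxc => fold_eq_zero hU0 hΓ0 hx hxc
  have hsob : ∀ k, IsStripSobolev p h (v k) (V k) := fun k =>
    (hu.isStripSobolev hp hS).fold (hσ k) (ht k) (hth k) (hz k) (hzt k) (τ k)
  let H : E (d + 1) → M m (d + 1) := fun x => Matrix.of fun i j => ∑ k, V k x i j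
  have hH0 : ∀ x ∈ strip d h, (∀ k, x ∉ cell d h S (τ k)) → H x = 0 := fun x hx hxc => by
    ext i j
    simp [H, (hzero _ x hx (hxc _)).2]
  have hH1 : ∀ k, ∀ x ∈ cell d h S (τ k), H x = V k x := fun k x hx => by
    ext i j
    simp only [H, Matrix.of_apply]
    refine Finset.sum_eq_single k (fun l _ hl => ?_) (by simp)
    rw [(hzero l x (mem_cell.1 hx).2 fun hxl => Set.disjoint_left.1 (hdisj l k hl) hxl hx).2]
    rfl
  refine ⟨fun x i => ∑ k, v k x i, H, (IsStripSobolev.sum hsob).isTestFunction ?_, ?_⟩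
  · intro x hx hxT
    have hn : ∀ k, x ∉ cell d h S (τ k) := fun k hk => hxT (hsub k hk)
    refine ⟨fun i => ?_, fun i j => ?_⟩
    · simp [(hzero _ x hx (hn _)).1]
    · simp [(hzero _ x hx (hn _)).2]
  have hvolS := volume_box_ne_top d h hS
  have hintW := integrableOn_growthWeight hp hvolS hu.1.memLp_grad B
  have hintf := integrableOn_energy hp hα hf hg hvolS hu.1.memLp_grad B
  let Φ : E (d + 1) → ℝ := (box d h S).indicator fun y => f y (B + G y) +
    η * growthWeight p (B + G y)
  let Θ : ι → E (d + 1) → ℝ := fun k => (box d h S ∩ layer d (σ k) h (t k)).indicator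
    fun y => β * growthWeight p (B + G y)
  let c := β * growthWeight p B
  have hc : 0 ≤ c := mul_nonneg hβ.le (growthWeight_pos _ _).le
  have hml : ∀ k, MeasurableSet (box d h S ∩ layer d (σ k) h (t k)) := fun k =>
    hmS.inter (measurableSet_layer _ _ _ _)
  have hΦint : Integrable Φ :=
    (integrable_indicator_iff hmS).2 (hintf.add (hintW.const_mul η))
  have hΘint : ∀ k, Integrable (Θ k) := fun k => (integrable_indicator_iff (hml k)).2
    ((hintW.mono_set Set.inter_subset_left).const_mul β)
  have hΦ0 : ∀ x, 0 ≤ Φ x := Set.indicator_nonneg fun y _ => add_nonneg (hg.nonneg hα _ _)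
    (mul_nonneg hη (growthWeight_pos _ _).le)
  have hΘ0 : ∀ k x, 0 ≤ Θ k x := fun k => Set.indicator_nonneg fun y _ =>
    mul_nonneg hβ.le (growthWeight_pos _ _).le
  let J : ι → E (d + 1) → ℝ := fun k x => Φ (x - pair (τ k) (z k)) +
    Θ k (foldImage (pair (τ k) (z k)) (foldPoint d (σ k) h (t k)) x)
  have hJ0 : ∀ k x, 0 ≤ J k x := fun k x => add_nonneg (hΦ0 _) (hΘ0 k _)
  have hJint : ∀ k, Integrable (J k) := fun k =>
    (hΦint.comp_sub_right _).add (integrable_comp_foldImage (hΘint k) _ _)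
  have h1int : ∀ {R : ℝ}, 0 < R → Integrable ((box d h R).indicator fun _ => (1 : ℝ)) :=
    fun {R} hR => (integrable_indicator_iff (measurableSet_box d h R)).2
      (integrableOn_const (volume_box_ne_top d h hR))
  let b1 : ι → E (d + 1) → ℝ := fun k x =>
    (box d h S).indicator (fun _ => (1 : ℝ)) (x - pair (τ k) 0)
  have hb1int : ∀ k, Integrable (b1 k) := fun k => (h1int hS).comp_sub_right _
  have hb1_mem : ∀ k, ∀ x ∈ cell d h S (τ k), b1 k x = 1 := fun k x hx =>
    Set.indicator_of_mem (show x - pair (τ k) 0 ∈ box d h S from hx) _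
  have hb1_not : ∀ k, ∀ x ∉ cell d h S (τ k), b1 k x = 0 := fun k x hx =>
    Set.indicator_of_notMem (show x - pair (τ k) 0 ∉ box d h S from hx) _
  -- At most one copy is active at each point, and where none is the gradient is zero and the energy
  -- is at most `c`. All integrals on the right are translation or reflection invariant.
  have hpt : ∀ x, (box d h T).indicator (fun x => f x (B + H x)) x ≤
      ∑ k, J k x + c * ((box d h T).indicator (fun _ => 1) x - ∑ k, b1 k x) := by
    intro x
    by_cases hx : ∃ k, x ∈ cell d h S (τ k)
    · obtain ⟨k, hk⟩ := hx
      have hsum : ∑ l, b1 l x = 1 := by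
        rw [Finset.sum_eq_single k (fun l _ hl => hb1_not l x fun hxl =>
          Set.disjoint_left.1 (hdisj l k hl) hxl hk) (by simp), hb1_mem k x hk]
      rw [Set.indicator_of_mem (hsub k hk), Set.indicator_of_mem (hsub k hk), hsum, hH1 k x hk]
      have h1 : f x (B + V k x) ≤ J k x :=
        energy_fold_le hα hg hβ hη (hσ k) (ht k) (hth k) (hz k) (hzt k) (hap k) A hk
      have h2 : J k x ≤ ∑ l, J l x :=
        Finset.single_le_sum (fun l _ => hJ0 l x) (Finset.mem_univ k)
      linarith
    · push Not at hx
      have hsum : ∑ l, b1 l x = 0 := Finset.sum_eq_zero fun l _ => hb1_not l x (hx l)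
      have hJ : 0 ≤ ∑ l, J l x := Finset.sum_nonneg fun l _ => hJ0 l x
      rw [hsum]
      by_cases hxT : x ∈ box d h T
      · rw [Set.indicator_of_mem hxT, Set.indicator_of_mem hxT, hH0 x hxT.2 hx, add_zero]
        have := (hg x B).2
        have h' : f x B ≤ c := this
        linarith
      · rw [Set.indicator_of_notMem hxT, Set.indicator_of_notMem hxT]
        linarith
  have hJint' : Integrable fun x => ∑ k, J k x := integrable_finsetSum _ fun k _ => hJint k
  have hbint' : Integrable fun x => ∑ k, b1 k x := integrable_finsetSum _ fun k _ => hb1int k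
  have hdiff : Integrable fun x => (box d h T).indicator (fun _ => 1) x - ∑ k, b1 k x :=
    (h1int hT).sub hbint'
  have hle : ∫ x in box d h T, f x (B + H x) ≤
      ∫ x, (∑ k, J k x + c * ((box d h T).indicator (fun _ => 1) x - ∑ k, b1 k x)) := by
    rw [← integral_indicator hmT]
    refine integral_mono_of_nonneg (ae_of_all _ (Set.indicator_nonneg fun y _ =>
      hg.nonneg hα _ _)) (hJint'.add (hdiff.const_mul c)) (ae_of_all _ hpt)
  have hJk : ∀ k, ∫ x, J k x ≤ (∫ x in box d h S, f x (B + G x)) +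
      η * (∫ x in box d h S, growthWeight p (B + G x)) + β * κ := by
    intro k
    have e1 : ∫ x, J k x = (∫ x, Φ (x - pair (τ k) (z k))) +
        ∫ x, Θ k (foldImage (pair (τ k) (z k)) (foldPoint d (σ k) h (t k)) x) :=
      integral_add (hΦint.comp_sub_right _) (integrable_comp_foldImage (hΘint k) _ _)
    rw [e1, integral_sub_right_eq_self Φ, integral_comp_foldImage, integral_indicator hmS,
      integral_indicator (hml k), integral_add hintf (hintW.const_mul η), integral_const_mul,
      integral_const_mul]
    exact add_le_add le_rfl (mul_le_mul_of_nonneg_left (hlayer k) hβ.le)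
  have hbk : ∀ k, ∫ x, b1 k x = 2 * h * S ^ d := fun k => by
    rw [integral_sub_right_eq_self ((box d h S).indicator fun _ => (1 : ℝ)),
      integral_indicator_box_one d hh hS]
  refine hle.trans ?_
  rw [integral_add hJint' (hdiff.const_mul c), integral_const_mul,
    integral_sub (h1int hT) hbint', integral_indicator_box_one d hh hT,
    integral_finsetSum _ fun k _ => hJint k, integral_finsetSum _ fun k _ => hb1int k]
  simp only [hbk, Finset.sum_const, Finset.card_univ, nsmul_eq_mul]
  refine add_le_add ?_ le_rfl
  calc ∑ k, ∫ x, J k x ≤ ∑ _k : ι, _ := Finset.sum_le_sum fun k _ => hJk k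
    _ = _ := by rw [Finset.sum_const, Finset.card_univ, nsmul_eq_mul]

/-! ### Existence of the limit for almost periodic densities -/

/-- Among `N` disjoint layers there is one that carries at most the `N`-th part of the mass. -/
theorem exists_layer_integral_le {d N : ℕ} (hN : 0 < N) {δ h S : ℝ} (hδ : 0 < δ) (σ : ℝ)
    {w : E (d + 1) → ℝ} (hw : IntegrableOn w (box d h S)) (hw0 : ∀ x, 0 ≤ w x) :
    ∃ k < N, ∫ x in box d h S ∩ layer d σ h (3 ^ k * δ), w x ≤
      (∫ x in box d h S, w x) / N := by
  let s : ℕ → Set (E (d + 1)) := fun k => box d h S ∩ layer d σ h (3 ^ k * δ)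
  have hsm : ∀ k, MeasurableSet (s k) := fun k =>
    (measurableSet_box d h S).inter (measurableSet_layer _ _ _ _)
  have hlt : ∀ k l, k < l → Disjoint (s k) (s l) := fun k l hkl => by
    refine Set.disjoint_left.2 fun x hk hl => ?_
    have h1 := hk.2.2
    have h2 := hl.2.1
    have h3 : (3 : ℝ) ^ (k + 1) ≤ 3 ^ l := pow_le_pow_right₀ (by norm_num) hkl
    have h4 := mul_le_mul_of_nonneg_right h3 hδ.le
    rw [pow_succ] at h4
    linarith
  have hsum : ∑ k ∈ Finset.range N, ∫ x in s k, w x ≤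
      ∑ _k ∈ Finset.range N, (∫ x in box d h S, w x) / N := by
    rw [← integral_biUnion_finset _ (fun k _ => hsm k) ?_
      (fun k _ => hw.mono_set Set.inter_subset_left)]
    · simp only [Finset.sum_const, Finset.card_range, nsmul_eq_mul]
      rw [mul_div_cancel₀ _ (by exact_mod_cast hN.ne')]
      refine setIntegral_mono_set hw (ae_of_all _ hw0) (LE.le.eventuallyLE ?_)
      exact Set.iUnion₂_subset fun k _ => Set.inter_subset_left
    · intro k _ l _ hkl
      rcases lt_or_gt_of_ne hkl with h' | h'
      · exact hlt k l h'
      · exact (hlt l k h').symm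
  obtain ⟨k, hk, hle⟩ := Finset.exists_le_of_sum_le (Finset.nonempty_range_iff.2 hN.ne') hsum
  exact ⟨k, Finset.mem_range.1 hk, hle⟩

theorem isTestFunction_zero {d m : ℕ} (p h T : ℝ) :
    IsTestFunction (d := d) (m := m) p h T 0 0 := by
  have hg : ∀ (Ω : Set (E (d + 1))) ψ, GreenIdentity (m := m) Ω 0 0 ψ := fun Ω ψ i j => by simp
  exact ⟨⟨fun i => MemLp.zero, fun i j => MemLp.zero, fun ψ _ _ _ => hg _ ψ⟩, fun ψ _ _ _ => hg _ ψ⟩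

section

variable {d m : ℕ} {p h α β : ℝ} {f : E (d + 1) → M m (d + 1) → ℝ}

theorem cellMin_le (hh : 0 < h) (hα : 0 < α) (hg : HasPGrowth p α β f) {A : M m d}
    {T : ℝ} (hT : 0 < T) {u : E (d + 1) → Fin m → ℝ} {G : E (d + 1) → M m (d + 1)}
    (hu : IsTestFunction p h T u G) :
    cellMin p h f A T ≤ 1 / (2 * h * T ^ d) * ∫ x in box d h T, f x (augment A 0 + G x) := by
  refine csInf_le ⟨0, ?_⟩ ⟨u, G, hu, rfl⟩
  rintro e ⟨v, H, -, rfl⟩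
  exact mul_nonneg (by positivity) (integral_nonneg fun x => hg.nonneg hα _ _)

theorem cellMin_nonneg (hh : 0 < h) (hα : 0 < α) (hg : HasPGrowth p α β f) (A : M m d)
    {T : ℝ} (hT : 0 < T) : 0 ≤ cellMin p h f A T := by
  refine Real.sInf_nonneg ?_
  rintro e ⟨v, H, -, rfl⟩
  exact mul_nonneg (by positivity) (integral_nonneg fun x => hg.nonneg hα _ _)

theorem cellMin_le_const (hh : 0 < h) (hα : 0 < α) (hg : HasPGrowth p α β f)
    (A : M m d) {T : ℝ} (hT : 0 < T) :
    cellMin p h f A T ≤ β * growthWeight p (augment A 0) := by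
  have hV : 0 < 2 * h * T ^ d := by positivity
  refine (cellMin_le hh hα hg hT (isTestFunction_zero p h T)).trans ?_
  have hle : ∫ x in box d h T, f x (augment A 0 + (0 : E (d + 1) → M m (d + 1)) x) ≤
      ∫ _x in box d h T, β * growthWeight p (augment A 0) := by
    refine integral_mono_of_nonneg (ae_of_all _ fun x => hg.nonneg hα _ _)
      (integrableOn_const (volume_box_ne_top d h hT)) (ae_of_all _ fun x => ?_)
    simp only [Pi.zero_apply, add_zero]
    exact (hg x (augment A 0)).2
  rw [setIntegral_const, Measure.real, volume_box d h hT, ENNReal.toReal_ofReal hV.le,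
    smul_eq_mul] at hle
  rw [one_div, inv_mul_le_iff₀ hV]
  exact hle

theorem exists_testFunction_lt (A : M m d) (T : ℝ) {ε : ℝ} (hε : 0 < ε) :
    ∃ (u : E (d + 1) → Fin m → ℝ) (G : E (d + 1) → M m (d + 1)), IsTestFunction p h T u G ∧
      1 / (2 * h * T ^ d) * ∫ x in box d h T, f x (augment A 0 + G x) <
        cellMin p h f A T + ε := by
  have hne : {e : ℝ | ∃ (u : E (d + 1) → Fin m → ℝ) (G : E (d + 1) → M m (d + 1)),
      IsTestFunction p h T u G ∧
      e = 1 / (2 * h * T ^ d) * ∫ x in box d h T, f x (augment A 0 + G x)}.Nonempty :=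
    ⟨_, 0, 0, isTestFunction_zero p h T, rfl⟩
  obtain ⟨e, ⟨u, G, hu, rfl⟩, he⟩ := exists_lt_of_csInf_lt hne
    (lt_add_of_pos_right (cellMin p h f A T) hε)
  exact ⟨u, G, hu, he⟩

/-- A set that meets every closed cube of side `L` contains points close to the nodes of a lattice
with spacing `S + L`, so that the cubes of side `S` at these points are disjoint. -/
theorem exists_packing (h : ℝ) {L S T : ℝ} (hL : 0 < L) (hS : 0 < S) (hT : 0 < T) {𝒯 : Set (E d)}
    (h𝒯 : 𝒯 + {v : E d | ∀ i, v i ∈ Set.Icc 0 L} = Set.univ) :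
    ∃ τ : (Fin d → Fin ⌊T / (S + L)⌋₊) → E d, (∀ k, τ k ∈ 𝒯) ∧
      (∀ k, cell d h S (τ k) ⊆ box d h T) ∧
      ∀ k l, k ≠ l → Disjoint (cell d h S (τ k)) (cell d h S (τ l)) := by
  have hSL : 0 < S + L := by positivity
  have hex : ∀ k : Fin d → Fin ⌊T / (S + L)⌋₊, ∃ τ ∈ 𝒯, ∀ i,
      (S + L) * (k i : ℝ) ≤ τ i ∧ τ i ≤ (S + L) * (k i : ℝ) + L := by
    intro k
    -- Decomposing the node moved by `L` puts `τ` between the node and its translate, so the cube of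
    -- side `S` at `τ` stays within one lattice cube of side `S + L`.
    have hx : WithLp.toLp 2 (fun i => (S + L) * (k i : ℝ) + L) ∈
        𝒯 + {v : E d | ∀ i, v i ∈ Set.Icc 0 L} := h𝒯 ▸ Set.mem_univ _
    obtain ⟨τ, hτ, v, hv, hsum⟩ := Set.mem_add.1 hx
    refine ⟨τ, hτ, fun i => ?_⟩
    have hi : τ i + v i = (S + L) * (k i : ℝ) + L := by
      rw [← PiLp.add_apply, hsum]
    have := hv i
    exact ⟨by linarith [this.2], by linarith [this.1]⟩
  choose τ hτ hτk using hex
  have hcell : ∀ k, ∀ x ∈ cell d h S (τ k), ∀ i : Fin d,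
      (S + L) * (k i : ℝ) < x i.castSucc ∧ x i.castSucc < (S + L) * ((k i : ℝ) + 1) := by
    intro k x hx i
    have h1 := (mem_cell.1 hx).1 i
    have h2 := hτk k i
    exact ⟨by linarith [h1.1, h2.1], by linarith [h1.2, h2.2]⟩
  refine ⟨τ, hτ, fun k x hx => ⟨fun i => ⟨?_, ?_⟩, (mem_cell.1 hx).2⟩, fun k l hkl => ?_⟩
  · exact (by positivity : 0 ≤ (S + L) * (k i : ℝ)).trans_lt (hcell k x hx i).1
  · refine (hcell k x hx i).2.trans_le ?_
    have h1 : ((k i : ℕ) : ℝ) + 1 ≤ ⌊T / (S + L)⌋₊ := by exact_mod_cast (k i).2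
    have h2 : (⌊T / (S + L)⌋₊ : ℝ) ≤ T / (S + L) := Nat.floor_le (by positivity)
    calc (S + L) * ((k i : ℝ) + 1) ≤ (S + L) * (T / (S + L)) :=
          mul_le_mul_of_nonneg_left (h1.trans h2) hSL.le
      _ = T := by field_simp
  · obtain ⟨i, hi⟩ := Function.ne_iff.1 hkl
    refine Set.disjoint_left.2 fun x hxk hxl => ?_
    have h1 := hcell k x hxk i
    have h2 := hcell l x hxl i
    have h3 := lt_of_mul_lt_mul_left (h1.1.trans h2.2) hSL.le
    have h4 := lt_of_mul_lt_mul_left (h2.1.trans h1.2) hSL.le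
    have h5 : (k i : ℕ) < (l i : ℕ) + 1 := by exact_mod_cast h3
    have h6 : (l i : ℕ) < (k i : ℕ) + 1 := by exact_mod_cast h4
    exact hi (Fin.ext (by omega))

/-- Comparison of the cell problems on a large and on a much larger cube. -/
theorem exists_cellMin_le_add (hp : 1 < p) (hh : 0 < h) (hα : 0 < α) (hβ : 0 < β)
    (hf : IsCaratheodory f) (hg : HasPGrowth p α β f) (hap : IsFilmAlmostPeriodic p f)
    (A : M m d) {ε : ℝ} (hε : 0 < ε) :
    ∃ L, 0 < L ∧ ∀ S T, 0 < S → 0 < T → cellMin p h f A T ≤ cellMin p h f A S + ε +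
      β * growthWeight p (augment A 0) * (1 - (⌊T / (S + L)⌋₊ * S / T) ^ d) := by
  classical
  set B := augment A 0 with hB
  set C := β * growthWeight p B with hC
  have hC0 : 0 ≤ C := mul_nonneg hβ.le (growthWeight_pos _ _).le
  -- By coercivity this bounds the mean of `1 + |B|^p` for any competitor of mean energy at most `C
  -- + 1`, independently of `S`.
  set D := 1 + (C + 1) / α with hD
  have hD0 : 0 < D := by positivity
  obtain ⟨N, hN⟩ := exists_nat_gt (4 * β * D / ε)
  have hN0 : (0 : ℝ) < N := lt_of_le_of_lt (by positivity) hN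
  have hNβ : β / N * D ≤ ε / 4 := by
    rw [div_lt_iff₀ hε] at hN
    rw [div_mul_eq_mul_div, div_le_iff₀ hN0]
    linarith
  -- All `N` layers then fit: `3 · 3^k δ ≤ h` for `k < N`.
  set δ := h / 3 ^ N with hδ
  have hδ0 : 0 < δ := by positivity
  -- The bound by `δ` keeps every vertical correction below the thickness of whichever layer is
  -- selected later; the other bound makes the almost-periodicity error at most `ε / 4`.
  set η := min δ (ε / (4 * D)) with hη
  have hη0 : 0 < η := lt_min hδ0 (by positivity)
  have hηD : η * D ≤ ε / 4 := by
    have h1 : η * D ≤ ε / (4 * D) * D := mul_le_mul_of_nonneg_right (min_le_right _ _) hD0.le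
    have h2 : ε / (4 * D) * D = ε / 4 := by field_simp
    linarith
  obtain ⟨L, hL, 𝒯, h𝒯, hτ⟩ := hap η hη0
  refine ⟨L, hL, fun S T hS hT => ?_⟩
  obtain ⟨τ, hτ𝒯, hsub, hdisj⟩ := exists_packing h hL hS hT h𝒯
  -- The cap by `1` gives mean energy at most `C + 1`, as used in `D`.
  obtain ⟨u, G, hu, hlt⟩ := exists_testFunction_lt (p := p) (h := h) (f := f) A S
    (lt_min (by positivity : 0 < ε / 2) one_pos)
  have hVS : 0 < 2 * h * S ^ d := by positivity
  have hvol := volume_box_ne_top d h hS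
  have hintW := integrableOn_growthWeight hp hvol hu.1.memLp_grad B
  have hintf := integrableOn_energy hp hα hf hg hvol hu.1.memLp_grad B
  set F := ∫ x in box d h S, f x (B + G x) with hF
  set I := ∫ x in box d h S, growthWeight p (B + G x) with hI
  set e := 1 / (2 * h * S ^ d) * F with he
  have heF : F = 2 * h * S ^ d * e := by rw [he]; field_simp
  have hF0 : 0 ≤ F := integral_nonneg fun x => hg.nonneg hα _ _
  have heC : e ≤ C + 1 := by
    have := cellMin_le_const hh hα hg A hS
    have h2 := min_le_right (ε / 2) 1
    linarith
  have hIF : I ≤ 2 * h * S ^ d * D := by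
    have h1 : I ≤ ∫ x in box d h S, (1 + f x (B + G x) / α) := by
      refine setIntegral_mono hintW ((integrableOn_const hvol).add (hintf.div_const α)) fun x => ?_
      have := (hg x (B + G x)).1
      simp only [growthWeight]
      rw [add_le_add_iff_left, le_div_iff₀ hα]
      linarith
    have h1int : Integrable (fun _ => (1 : ℝ)) (volume.restrict (box d h S)) :=
      integrableOn_const hvol
    rw [integral_add h1int (hintf.div_const α), integral_div,
      setIntegral_const, Measure.real, volume_box d h hS, ENNReal.toReal_ofReal hVS.le] at h1
    have h2 : F / α ≤ 2 * h * S ^ d * ((C + 1) / α) := by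
      rw [heF, mul_div_assoc]
      exact mul_le_mul_of_nonneg_left (div_le_div_of_nonneg_right heC hα.le) hVS.le
    calc I ≤ _ := h1
      _ ≤ 2 * h * S ^ d * 1 + 2 * h * S ^ d * ((C + 1) / α) := by
          rw [smul_eq_mul]; exact add_le_add le_rfl h2
      _ = _ := by rw [hD]; ring
  have hlay : ∀ σ : ℝ, ∃ k < N, ∫ x in box d h S ∩ layer d σ h (3 ^ k * δ),
      growthWeight p (B + G x) ≤ I / N := fun σ =>
    exists_layer_integral_le (by exact_mod_cast hN0) hδ0 σ hintW fun x => (growthWeight_pos _ _).le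
  choose κ hκN hκ using hlay
  choose z hz hfz using fun k => hτ (τ k) (hτ𝒯 k)
  -- The kept side is the one towards which the copy is shifted, so that the reflection fills the
  -- gap at the opposite face.
  let σ : (Fin d → Fin ⌊T / (S + L)⌋₊) → ℝ := fun k => if 0 ≤ z k then 1 else -1
  have hσ : ∀ k, σ k = 1 ∨ σ k = -1 := fun k => by
    simp only [σ]; split_ifs <;> simp
  have hσz : ∀ k, σ k * z k = |z k| := fun k => by
    simp only [σ]
    split_ifs with h0
    · rw [abs_of_nonneg h0, one_mul]
    · rw [abs_of_neg (not_le.1 h0)]; ring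
  have hδt : ∀ k, δ ≤ 3 ^ κ (σ k) * δ := fun k =>
    le_mul_of_one_le_left hδ0.le (one_le_pow₀ (by norm_num))
  obtain ⟨v, H, hv, hvH⟩ := exists_testFunction_glued hp hh hα hβ hη0.le hS hT hf hg A hu
    (τ := τ) (z := z) (σ := σ) (t := fun k => 3 ^ κ (σ k) * δ) (κ := I / N) hσ
    (fun k => by positivity)
    (fun k => by
      have h1 : (3 : ℝ) ^ (κ (σ k) + 1) ≤ 3 ^ N := pow_le_pow_right₀ (by norm_num) (hκN (σ k))
      have h2 : (3 : ℝ) ^ N * δ = h := by rw [hδ]; field_simp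
      have h3 := mul_le_mul_of_nonneg_right h1 hδ0.le
      rw [pow_succ] at h3
      linarith)
    (fun k => by rw [hσz]; exact abs_nonneg _)
    (fun k => by
      rw [hσz]
      exact (hz k).le.trans ((min_le_left _ _).trans (hδt k)))
    hfz (fun k => hκ (σ k)) hsub hdisj
  refine (cellMin_le hh hα hg hT hv).trans ?_
  rw [← hB, ← hF, ← hI, ← hC] at hvH
  simp only [Fintype.card_pi, Fintype.card_fin, Finset.prod_const, Finset.card_univ,
    Nat.cast_pow] at hvH
  set K : ℝ := ((⌊T / (S + L)⌋₊ : ℕ) : ℝ) with hK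
  have hK0 : 0 ≤ K := Nat.cast_nonneg _
  have hKT : K * S ≤ T := by
    have h2 : K ≤ T / (S + L) := Nat.floor_le (by positivity)
    rw [le_div_iff₀ (by positivity)] at h2
    have h3 : 0 ≤ K * L := by positivity
    linarith
  -- The fraction of the large box covered by the cells.
  set θ := (K * S / T) ^ d with hθ
  have hθ0 : 0 ≤ θ := by positivity
  have hθ1 : θ ≤ 1 := pow_le_one₀ (by positivity) ((div_le_one hT).2 hKT)
  have hθeq : K ^ d * (2 * h * S ^ d) = 2 * h * T ^ d * θ := by
    rw [hθ, div_pow, mul_pow]; field_simp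
  have hpart : F + η * I + β * (I / N) ≤ 2 * h * S ^ d * (e + ε / 2) := by
    have h1 : (η + β / N) * I ≤ (η + β / N) * (2 * h * S ^ d * D) :=
      mul_le_mul_of_nonneg_left hIF (by positivity)
    have h2 : (η + β / N) * D ≤ ε / 2 := by rw [add_mul]; linarith
    have h3 := mul_le_mul_of_nonneg_left h2 hVS.le
    have h4 : β * (I / N) = β / N * I := by ring
    rw [heF, h4]
    linarith
  have he0 : 0 ≤ e := by rw [he]; positivity
  calc 1 / (2 * h * T ^ d) * ∫ x in box d h T, f x (B + H x)
      ≤ 1 / (2 * h * T ^ d) * (K ^ d * (2 * h * S ^ d * (e + ε / 2)) +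
          C * (2 * h * T ^ d - K ^ d * (2 * h * S ^ d))) := by
        refine mul_le_mul_of_nonneg_left (hvH.trans (add_le_add ?_ le_rfl)) (by positivity)
        exact mul_le_mul_of_nonneg_left hpart (by positivity)
    _ = θ * (e + ε / 2) + C * (1 - θ) := by
        rw [← mul_assoc (K ^ d), hθeq]; field_simp
    _ ≤ (e + ε / 2) + C * (1 - θ) := by
        have := mul_le_of_le_one_left (by positivity : 0 ≤ e + ε / 2) hθ1
        linarith
    _ ≤ _ := by
        have h2 := min_le_left (ε / 2) 1
        linarith

end

/-- Bernoulli's inequality, with linear loss `L / S` from the gaps between cells and `S / T` from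
rounding down. -/
theorem one_sub_floor_pow_le (d : ℕ) {L S T : ℝ} (hL : 0 < L) (hS : 0 < S) (hT : 0 < T) :
    1 - (⌊T / (S + L)⌋₊ * S / T) ^ d ≤ d * (L / S + S / T) := by
  set K : ℝ := ((⌊T / (S + L)⌋₊ : ℕ) : ℝ) with hK
  have hK0 : 0 ≤ K := Nat.cast_nonneg _
  have h1 : T / (S + L) - 1 ≤ K := (Nat.sub_one_lt_floor _).le
  have h2 : 1 - (L / S + S / T) ≤ K * S / T := by
    have h3 : (T / (S + L) - 1) * S / T ≤ K * S / T := by gcongr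
    have h4 : (T / (S + L) - 1) * S / T = 1 - L / (S + L) - S / T := by field_simp; ring
    have h5 : L / (S + L) ≤ L / S := by gcongr; linarith
    linarith
  have h6 := one_add_mul_le_pow (a := K * S / T - 1)
    (by have : 0 ≤ K * S / T := by positivity
        linarith) d
  rw [add_sub_cancel] at h6
  have h7 : (d : ℝ) * (1 - (L / S + S / T)) ≤ d * (K * S / T) :=
    mul_le_mul_of_nonneg_left h2 d.cast_nonneg
  linarith

/-- A bounded function that is eventually almost dominated by each of its values far out has a
limit at infinity. -/
theorem exists_tendsto_atTop_of_le_add {g : ℝ → ℝ} {C : ℝ}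
    (h0 : ∀ᶠ T in atTop, 0 ≤ g T) (hC : ∀ᶠ T in atTop, g T ≤ C)
    (h : ∀ ε > 0, ∀ᶠ S in atTop, ∀ᶠ T in atTop, g T ≤ g S + ε) :
    ∃ ℓ, Tendsto g atTop (𝓝 ℓ) := by
  have hbu : IsBoundedUnder (· ≤ ·) atTop g := ⟨C, hC⟩
  have hbl : IsBoundedUnder (· ≥ ·) atTop g := ⟨0, h0⟩
  refine ⟨limsup g atTop, tendsto_of_le_liminf_of_limsup_le ?_ le_rfl hbu hbl⟩
  refine le_of_forall_pos_le_add fun ε hε => ?_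
  -- For fixed `S` the upper limit is taken in `T`; the lower limit is then taken in `S`.
  have : limsup g atTop - ε ≤ liminf g atTop := by
    refine le_liminf_of_le hbu.isCoboundedUnder_ge ?_
    filter_upwards [h ε hε] with S hS
    have := limsup_le_of_le hbl.isCoboundedUnder_le hS
    linarith
  linarith

theorem exists_tendsto_cellMin {d m : ℕ} {p h α β : ℝ} {f : E (d + 1) → M m (d + 1) → ℝ}
    (hp : 1 < p) (hh : 0 < h) (hα : 0 < α) (hβ : 0 < β) (hf : IsCaratheodory f)
    (hg : HasPGrowth p α β f) (hap : IsFilmAlmostPeriodic p f) (A : M m d) :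
    ∃ ℓ : ℝ, Tendsto (fun T : ℝ => cellMin p h f A T) atTop (𝓝 ℓ) := by
  set C := β * growthWeight p (augment A 0) with hC
  have hC0 : 0 ≤ C := mul_nonneg hβ.le (growthWeight_pos _ _).le
  refine exists_tendsto_atTop_of_le_add (C := C) ?_ ?_ ?_
  · filter_upwards [eventually_gt_atTop 0] with T hT using cellMin_nonneg hh hα hg A hT
  · filter_upwards [eventually_gt_atTop 0] with T hT using cellMin_le_const hh hα hg A hT
  intro ε hε
  obtain ⟨L, hL, hLS⟩ := exists_cellMin_le_add hp hh hα hβ hf hg hap A (half_pos hε)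
  have hlimS : Tendsto (fun S : ℝ => C * (d * (L / S + 0))) atTop (𝓝 (C * (d * (0 + 0)))) :=
    (((tendsto_const_nhds.div_atTop tendsto_id).add_const 0).const_mul _).const_mul _
  filter_upwards [eventually_gt_atTop 0,
    hlimS.eventually (gt_mem_nhds (by simpa using half_pos hε : C * (d * (0 + 0)) < ε / 2))]
    with S hS hSε
  have hlimT : Tendsto (fun T : ℝ => C * (d * (L / S + S / T))) atTop
      (𝓝 (C * (d * (L / S + 0)))) :=
    (((tendsto_const_nhds.div_atTop tendsto_id).const_add _).const_mul _).const_mul _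
  filter_upwards [eventually_gt_atTop 0, hlimT.eventually (gt_mem_nhds hSε)] with T hT hTε
  have h1 := hLS S T hS hT
  have h2 := mul_le_mul_of_nonneg_left (one_sub_floor_pow_le d hL hS hT) hC0
  linarith

/-! ### Thin sections of periodic media -/

theorem matNorm_eq_sqrt_trace {m n : ℕ} (B : M m n) :
    matNorm B = Real.sqrt (B * B.transpose).trace := by
  simp [matNorm, Matrix.trace, Matrix.mul_apply, sq]

theorem matNorm_mul_of_orthogonal {m n : ℕ} {Q : M n n} (hQ : Q * Q.transpose = 1) (B : M m n) :
    matNorm (B * Q) = matNorm B := by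
  rw [matNorm_eq_sqrt_trace, matNorm_eq_sqrt_trace, Matrix.transpose_mul, Matrix.mul_assoc,
    ← Matrix.mul_assoc Q, hQ, Matrix.one_mul]

/-- The columns are the images of an orthonormal basis under an isometry. Orthogonality is what
carries the growth bounds over to `filmDensity` with the same constants. -/
theorem gradMatrix_transpose_mul_self {n : ℕ} (φ : E n ≃ₗᵢ[ℝ] E n) :
    (gradMatrix φ).transpose * gradMatrix φ = 1 := by
  ext j k
  have h1 : inner ℝ (φ (EuclideanSpace.single k 1)) (φ (EuclideanSpace.single j 1)) =
      inner ℝ (EuclideanSpace.single k (1 : ℝ)) (EuclideanSpace.single j (1 : ℝ)) :=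
    φ.inner_map_map _ _
  simp only [PiLp.inner_apply (φ _)] at h1
  simp only [Matrix.mul_apply, Matrix.transpose_apply, gradMatrix, Matrix.of_apply,
    Matrix.one_apply]
  simp only [RCLike.inner_apply, conj_trivial] at h1
  rw [h1]
  by_cases hjk : j = k
  · subst hjk; simp
  · rw [EuclideanSpace.inner_single_left]
    simp [hjk, Ne.symm hjk]

theorem orthogonal_of_eq_gradMatrix_or_inv {n : ℕ} {φ : E n ≃ₗᵢ[ℝ] E n} {Q : M n n}
    (hQ : Q = gradMatrix φ ∨ Q = (gradMatrix φ)⁻¹) : Q * Q.transpose = 1 := by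
  have h := gradMatrix_transpose_mul_self φ
  rcases hQ with rfl | rfl
  · exact mul_eq_one_comm.1 h
  · rw [Matrix.inv_eq_left_inv h, Matrix.transpose_transpose, h]

theorem IsCaratheodory.filmDensity {n m : ℕ} {f : E n → M m n → ℝ} (hf : IsCaratheodory f)
    (φ : E n ≃ₗᵢ[ℝ] E n) (Q : M n n) : IsCaratheodory (filmDensity φ Q f) where
  measurable_left A := (hf.measurable_left (A * Q)).comp_quasiMeasurePreserving
    φ.measurePreserving.quasiMeasurePreserving
  continuous_right := by
    filter_upwards [φ.measurePreserving.quasiMeasurePreserving.ae hf.continuous_right] with x hx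
    exact hx.comp (continuous_id.matrix_mul continuous_const)

theorem HasPGrowth.filmDensity {n m : ℕ} {p α β : ℝ} {f : E n → M m n → ℝ}
    (hf : HasPGrowth p α β f) (φ : E n ≃ₗᵢ[ℝ] E n) {Q : M n n} (hQ : Q * Q.transpose = 1) :
    HasPGrowth p α β (filmDensity φ Q f) := fun x A => by
  simpa only [ThinFilm.filmDensity, matNorm_mul_of_orthogonal hQ] using hf (φ x) (A * Q)

/-- The point of `ℝ^n` with integer coordinates `k`. -/
def intPoint {n : ℕ} (k : Fin n → ℤ) : E n := WithLp.toLp 2 fun i => (k i : ℝ)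

theorem intPoint_sub {n : ℕ} (k l : Fin n → ℤ) : intPoint (k - l) = intPoint k - intPoint l := by
  ext i; simp [intPoint]

theorem IsUnitPeriodic.add_intPoint {n m : ℕ} {f : E n → M m n → ℝ} (hf : IsUnitPeriodic f)
    (k : Fin n → ℤ) (x : E n) (B : M m n) : f (x + intPoint k) B = f x B := by
  let P : AddSubgroup (E n) :=
    { carrier := {v | ∀ x, f (x + v) B = f x B}
      zero_mem' := fun x => by simp
      add_mem' := fun {v w} hv hw x => by rw [← add_assoc, hw, hv]
      neg_mem' := fun {v} hv x => by simpa using (hv (x + -v)).symm }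
  have hk : intPoint k = ∑ i, k i • EuclideanSpace.single i (1 : ℝ) := by
    ext j
    simp [intPoint, Pi.single_apply]
  have : intPoint k ∈ P := by
    rw [hk]
    exact P.sum_mem fun i _ => P.zsmul_mem (fun x => hf x B i) _
  exact this x

theorem norm_intPoint_floor_sub_le {n : ℕ} (x : E n) :
    ‖intPoint (fun i => ⌊x i⌋) - x‖ ≤ Real.sqrt n := by
  rw [EuclideanSpace.norm_eq]
  refine Real.sqrt_le_sqrt ?_
  calc ∑ i, ‖(intPoint (fun i => ⌊x i⌋) - x) i‖ ^ 2 ≤ ∑ _i : Fin n, (1 : ℝ) := by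
        refine Finset.sum_le_sum fun i _ => ?_
        rw [Real.norm_eq_abs, sq_abs]
        simp only [intPoint, PiLp.sub_apply]
        have h1 := Int.floor_le (x i)
        have h2 := Int.lt_floor_add_one (x i)
        nlinarith
    _ = n := by simp

/-- The integer points whose images under a linear isometry have a small last coordinate are
relatively dense in the film directions. -/
theorem exists_intPoint_near {d : ℕ} (φ : E (d + 1) ≃ₗᵢ[ℝ] E (d + 1)) {η : ℝ} (hη : 0 < η) :
    ∃ ρ : ℝ, 0 < ρ ∧ ∀ x : E d, ∃ k : Fin (d + 1) → ℤ,
      |φ.symm (intPoint k) (Fin.last d)| < η ∧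
      ∀ i : Fin d, |φ.symm (intPoint k) i.castSucc - x i| ≤ ρ := by
  set r := Real.sqrt (d + 1 : ℕ) with hr
  let π : (Fin (d + 1) → ℤ) → ℝ := fun k => φ.symm (intPoint k) (Fin.last d)
  -- Heights of integer points need not be discrete, but those in a bounded interval have a finite
  -- `η`-net consisting of such heights.
  have hΓ : TotallyBounded (Set.range π ∩ Set.Icc (-r) r) :=
    isCompact_Icc.totallyBounded.subset Set.inter_subset_right
  obtain ⟨t, htΓ, htf, hcov⟩ := Metric.finite_approx_of_totallyBounded hΓ η hη
  -- An integer point realising each height of the net; outside the net the value is irrelevant.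
  have hex : ∀ s : ℝ, ∃ k, s ∈ t → π k = s := fun s => by
    by_cases hs : s ∈ t
    · obtain ⟨k, hk⟩ := (htΓ hs).1
      exact ⟨k, fun _ => hk⟩
    · exact ⟨0, fun h => absurd h hs⟩
  choose κ hκ using hex
  obtain ⟨ρ, hρ⟩ := (htf.image fun s => ‖intPoint (κ s)‖).bddAbove
  have hρ' : ∀ s ∈ t, ‖intPoint (κ s)‖ ≤ ρ := fun s hs => hρ (Set.mem_image_of_mem _ hs)
  refine ⟨r + |ρ| + 1, by positivity, fun x => ?_⟩
  set X := φ (pair x 0) with hX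
  -- Rounding gives an integer point within `r` of the target, hence of height in `[-r, r]`.
  set k₀ : Fin (d + 1) → ℤ := fun i => ⌊X i⌋ with hk₀
  have hfloor : ‖intPoint k₀ - X‖ ≤ r := norm_intPoint_floor_sub_le X
  have hcoord : ∀ (k : Fin (d + 1) → ℤ) (i : Fin (d + 1)),
      |φ.symm (intPoint k) i - pair x 0 i| ≤ ‖intPoint k - X‖ := fun k i => by
    have h1 : φ.symm (intPoint k) - pair x 0 = φ.symm (intPoint k - X) := by
      rw [map_sub, hX, φ.symm_apply_apply]
    rw [← PiLp.sub_apply, h1, ← φ.symm.norm_map (intPoint k - X)]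
    exact PiLp.norm_apply_le (φ.symm (intPoint k - X)) i
  have hπ₀ : |π k₀| ≤ r := by
    have := hcoord k₀ (Fin.last d)
    rw [pair_last, sub_zero] at this
    exact this.trans hfloor
  have hmem := hcov ⟨⟨k₀, rfl⟩, abs_le.1 hπ₀⟩
  simp only [Set.mem_iUnion, Metric.mem_ball, exists_prop, Real.dist_eq] at hmem
  obtain ⟨s, hs, hlt⟩ := hmem
  -- Subtracting the net point of nearly equal height leaves a height below `η` and moves the point
  -- by at most `ρ`.
  refine ⟨k₀ - κ s, ?_, fun i => ?_⟩
  · rw [intPoint_sub, map_sub, PiLp.sub_apply]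
    have := hκ s hs
    simp only [π] at this hlt
    rwa [this]
  · have h1 := hcoord (k₀ - κ s) i.castSucc
    rw [pair_castSucc] at h1
    refine h1.trans ?_
    have h2 : ‖intPoint (k₀ - κ s) - X‖ ≤ ‖intPoint k₀ - X‖ + ‖intPoint (κ s)‖ := by
      rw [intPoint_sub, sub_right_comm]
      exact norm_sub_le _ _
    have h3 := hρ' s hs
    have h4 := le_abs_self ρ
    linarith

theorem IsUnitPeriodic.isFilmAlmostPeriodic {d m : ℕ} {f : E (d + 1) → M m (d + 1) → ℝ}
    (hf : IsUnitPeriodic f) (p : ℝ) (φ : E (d + 1) ≃ₗᵢ[ℝ] E (d + 1)) (Q : M (d + 1) (d + 1)) :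
    IsFilmAlmostPeriodic p (filmDensity φ Q f) := by
  intro η hη
  obtain ⟨ρ, hρ, hnear⟩ := exists_intPoint_near φ hη
  refine ⟨2 * ρ, by positivity,
    {τ | ∃ (k : Fin (d + 1) → ℤ) (z : ℝ), φ.symm (intPoint k) = pair τ z ∧ |z| < η}, ?_, ?_⟩
  · refine Set.eq_univ_of_forall fun x => ?_
    -- Recentring by `ρ` turns the two-sided bound into `x - τ ∈ [0, 2ρ]^d`.
    obtain ⟨k, hk, hki⟩ := hnear (x - WithLp.toLp 2 fun _ => ρ)
    set τ : E d := WithLp.toLp 2 fun i => φ.symm (intPoint k) i.castSucc with hτ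
    refine Set.mem_add.2 ⟨τ, ⟨k, φ.symm (intPoint k) (Fin.last d), ?_, hk⟩, x - τ, fun i => ?_,
      add_sub_cancel _ _⟩
    · ext i
      refine Fin.lastCases ?_ (fun j => ?_) i <;> simp [hτ]
    · have h1 := abs_le.1 (hki i)
      simp only [PiLp.sub_apply] at h1
      simp only [PiLp.sub_apply, hτ]
      exact ⟨by linarith [h1.2], by linarith [h1.1]⟩
  · rintro τ ⟨k, z, hkz, hz⟩
    refine ⟨z, hz, fun x A => ?_⟩
    have h1 : filmDensity φ Q f (x + pair τ z) A = filmDensity φ Q f x A := by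
      simp only [filmDensity]
      rw [map_add, ← hkz, φ.apply_symm_apply, hf.add_intPoint]
    rw [h1, sub_self, abs_zero]
    exact mul_nonneg hη.le (growthWeight_pos p A).le

end ThinFilm

/-- Existence of `lim_{T → ∞} g_A(T)`, (i) for every geometrically almost periodic density `f`,
and (ii) for every density obtained from a periodic medium by cutting along the hyperplane
orthogonal to an arbitrary unit vector `ν`. -/
theorem mainTheorem3 (d m : ℕ) (p h α β : ℝ) (hp : 1 < p) (hh : 0 < h) (hα : 0 < α) (hβ : 0 < β)
    (A : ThinFilm.M m d) :
    (∀ f : ThinFilm.E (d + 1) → ThinFilm.M m (d + 1) → ℝ,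
      ThinFilm.IsCaratheodory f → ThinFilm.HasPGrowth p α β f →
      ThinFilm.IsFilmAlmostPeriodic p f →
      ∃ ℓ : ℝ, Filter.Tendsto (fun T : ℝ => ThinFilm.cellMin p h f A T) Filter.atTop (nhds ℓ)) ∧
    (∀ ftilde : ThinFilm.E (d + 1) → ThinFilm.M m (d + 1) → ℝ,
      ThinFilm.IsCaratheodory ftilde → ThinFilm.HasPGrowth p α β ftilde →
      ThinFilm.IsUnitPeriodic ftilde →
      ∀ (ν : ThinFilm.E (d + 1)) (φ : ThinFilm.E (d + 1) ≃ₗᵢ[ℝ] ThinFilm.E (d + 1)),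
        ‖ν‖ = 1 → ThinFilm.IsFilmFrame ν φ →
        ∀ Q : ThinFilm.M (d + 1) (d + 1),
          (Q = ThinFilm.gradMatrix φ ∨ Q = (ThinFilm.gradMatrix φ)⁻¹) →
          ∃ ℓ : ℝ, Filter.Tendsto
            (fun T : ℝ => ThinFilm.cellMin p h (ThinFilm.filmDensity φ Q ftilde) A T)
            Filter.atTop (nhds ℓ)) := by
  refine ⟨fun f hf hg hap => ThinFilm.exists_tendsto_cellMin hp hh hα hβ hf hg hap A, ?_⟩
  intro ftilde hf hg hper ν φ _ _ Q hQ
  exact ThinFilm.exists_tendsto_cellMin hp hh hα hβ (hf.filmDensity φ Q)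
    (hg.filmDensity φ (ThinFilm.orthogonal_of_eq_gradMatrix_or_inv hQ))
    (hper.isFilmAlmostPeriodic p φ Q) A
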